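/- Let $\xi_1,\xi_2,\dots\ge 0$ (claim sizes) and $\tau_1,\tau_2,\dots\ge0$ (inter-claim times) be two independent i.i.d. sequences, with generic copies $\xi$ and $\tau$, and $\mathbb E\tau>0$. Put $T_n=\tau_1+\dots+\tau_n$, $T_0=0$, and $N(t)=\max\{n\ge 0: T_n\le t\}$. Let $v:\mathbb R\to[0,\infty)$ be measurable and bounded. For every $x>0$ let $R_x$ be a risk reserve process with premium rate $v$ and initial reserve $x$, that is, almost surely $$R_x(t)=x+\int_0^t v(R_x(s))\,ds-\sum_{j=1}^{N(t)}\xi_j\qquad\text{for all }t\ge 0,$$ and let $\psi(x)=\mathbb P\{R_x(t)<0\text{ for some }t\ge0\}$ be its ruin probability. Put $v_c=\mathbb E\xi/\mathbb E\tau$, and assume that for some real $\theta$ $$\Bigl|v(z)-v_c-\frac{\theta}{z}\Bigr|\le p(z)\quad\text{for all }z>1,\qquad \theta>\frac{\operatorname{Var}\xi+v_c^2\operatorname{Var}\tau}{2\,\mathbb E\tau},$$ where $p>0$ is a decreasing function that is integrable at infinity. Put $$\rho=\frac{2\theta\,\mathbb E\tau}{\operatorname{Var}\xi+v_c^2\operatorname{Var}\tau}-1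 .$$ Assume also that $\mathbb E\,\tau^2\log(1+\tau)<\infty$ and that $\mathbb P\{\xi>x\}=x^{-2-\beta}L(x)$ for all $x>0$, where $\beta\in(0,\rho)$ and $L$ is slowly varying at infinity. Then $\int_0^\infty y\,\mathbb P\{\xi>y\}\,dy<\infty$, and there exist constants $C_1,C_2>0$ such that $$C_1\int_x^\infty y\,\mathbb P\{\xi>y\}\,dy\le\psi(x)\le C_2\int_x^\infty y\,\mathbb P\{\xi>y\}\,dy\qquad\text{for all }x>0 .$$ Moreover, for every $x_0>0$ there exist constants $\widehat C_1,\widehat C_2>0$ such that $$\widehat C_1\,x^2\,\mathbb P\{\xi>x\}\le\psi(x)\le\widehat C_2\,x^2\,\mathbb P\{\xi>x\}\qquad\text{for all }x\ge x_0 .$$ -/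

import Mathlib

open MeasureTheory ProbabilityTheory Filter Topology

/-- The `n`-th claim epoch `T_n = τ_1 + ⋯ + τ_n` (with `T_0 = 0`); the inter-claim times are indexed
from `0`, so that `τ n` is the time between the `n`-th and the `(n+1)`-st claim. -/
noncomputable def claimEpoch {Ω : Type*} (τ : ℕ → Ω → ℝ) (n : ℕ) (ω : Ω) : ℝ :=
  ∑ i ∈ Finset.range n, τ i ω

/-- The number of claims up to time `t`, that is `N(t) = max {n : T_n ≤ t}`. (When the inter-claim
times are i.i.d., nonnegative and of positive mean, this set is almost surely finite for all `t`.) -/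
noncomputable def claimCount {Ω : Type*} (τ : ℕ → Ω → ℝ) (t : ℝ) (ω : Ω) : ℕ :=
  sSup {n : ℕ | claimEpoch τ n ω ≤ t}

/-- `R` is a risk reserve process with level-dependent premium rate `v`, inter-claim times `τ`,
claim sizes `ξ` and initial reserve `x`: almost surely, for all `t ≥ 0`,
`R(t) = x + ∫_0^t v(R(s)) ds - ∑_{j ≤ N(t)} ξ_j`. -/
def IsRiskReserve {Ω : Type*} [MeasurableSpace Ω] (μ : Measure Ω) (v : ℝ → ℝ)
    (τ ξ : ℕ → Ω → ℝ) (x : ℝ) (R : ℝ → Ω → ℝ) : Prop :=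
  ∀ᵐ ω ∂μ, ∀ t : ℝ, 0 ≤ t →
    IntervalIntegrable (fun s => v (R s ω)) volume 0 t ∧
    R t ω = x + (∫ s in (0 : ℝ)..t, v (R s ω)) - ∑ j ∈ Finset.range (claimCount τ t ω), ξ j ω

/-- The probability of ruin `P{R(t) < 0 for some t ≥ 0}`. -/
noncomputable def ruinProb {Ω : Type*} [MeasurableSpace Ω] (μ : Measure Ω) (R : ℝ → Ω → ℝ) : ℝ :=
  μ.real {ω | ∃ t : ℝ, 0 ≤ t ∧ R t ω < 0}

/-- The critical premium rate `v_c = E ξ / E τ`. -/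
noncomputable def criticalRate {Ω : Type*} [MeasurableSpace Ω] (μ : Measure Ω) (τ ξ : Ω → ℝ) : ℝ :=
  (∫ ω, ξ ω ∂μ) / (∫ ω, τ ω ∂μ)

/-- The quantity `Var ξ + v_c² Var τ`. -/
noncomputable def limitVariance {Ω : Type*} [MeasurableSpace Ω] (μ : Measure Ω) (τ ξ : Ω → ℝ) : ℝ :=
  variance ξ μ + criticalRate μ τ ξ ^ 2 * variance τ μ

/-- The exponent `ρ = 2 θ E τ / (Var ξ + v_c² Var τ) - 1`. -/
noncomputable def ruinExponent {Ω : Type*} [MeasurableSpace Ω] (μ : Measure Ω) (τ ξ : Ω → ℝ)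
    (θ : ℝ) : ℝ :=
  2 * θ * (∫ ω, τ ω ∂μ) / limitVariance μ τ ξ - 1

/-- The function `v` approaches `c` at infinity at rate `θ / z`: one has `|v(z) - c - θ/z| ≤ p(z)`
for all `z > 1`, for some positive decreasing function `p` that is integrable at infinity. -/
def ApproachesAtRate (v : ℝ → ℝ) (c θ : ℝ) : Prop :=
  ∃ p : ℝ → ℝ, (∀ z, 1 < z → 0 < p z) ∧ AntitoneOn p (Set.Ioi 1) ∧
    IntegrableAtFilter p atTop volume ∧ ∀ z, 1 < z → |v z - c - θ / z| ≤ p z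

/-- A function that is slowly varying at infinity. -/
def SlowlyVarying (L : ℝ → ℝ) : Prop :=
  Measurable L ∧ (∀ᶠ x in atTop, 0 < L x) ∧
    ∀ c : ℝ, 0 < c → Tendsto (fun x => L (c * x) / L x) atTop (𝓝 1)

/-!
Write `F x = P(ξ > x)`. Just after the claims, the reserve moves from a high level `x` by jumps of
mean about `θ E[τ] / x` and variance about `σ² = Var ξ + v_c² Var τ`, so that `x ^ (-ρ)` is nearly
harmonic for it.

Upper bound: for `β < b < ρ` the functions `x ↦ s ^ (2 + b) / (x ^ 2 + s ^ 2) ^ (b / 2)` are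
superharmonic at high levels, up to the effect of jumps comparable with `x`. Mixing them over the
claim law in `s` gives a function `V` of the order of `x ^ 2 F x`, whose drift is negative enough to
absorb the big claims as well. Truncating the inter-claim times only lowers the reserve, hence the
optional stopping bound `ψ x ≤ V x / V x₁`.

Lower bound: during the first `ε x ^ 2` claims the reserve stays `O(x)` with probability at least
`1 / 2`, by a second moment bound for a reflected random walk that dominates it. Each of these
claims independently exceeds a large multiple of `x` with probability of the order of `F x`.

By Karamata's theorem `∫_x^∞ y F y dy` is of the same order as `x ^ 2 F x`.
-/

section Doubling

/-- Doubling a large argument multiplies `F` by at most a factor strictly smaller than `2 ^ a`. For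
positive monotone `F` this says that the upper Matuszewska index of `F` is smaller than `a`. -/
def DoublingLT (F : ℝ → ℝ) (a : ℝ) : Prop :=
  ∃ r ∈ Set.Ioo 0 (2 ^ a), ∀ᶠ x in atTop, F (2 * x) ≤ r * F x

/-- Doubling a large argument multiplies `F` by at least a factor strictly larger than `2 ^ a`. For
positive monotone `F` this says that the lower Matuszewska index of `F` is larger than `a`. -/
def DoublingGT (F : ℝ → ℝ) (a : ℝ) : Prop :=
  ∃ r > 2 ^ a, ∀ᶠ x in atTop, r * F x ≤ F (2 * x)

variable {F : ℝ → ℝ} {a p : ℝ}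

theorem DoublingLT.rpow_mul (h : DoublingLT F a) (p : ℝ) :
    DoublingLT (fun x => x ^ p * F x) (a + p) := by
  obtain ⟨r, ⟨hr₀, hr⟩, hF⟩ := h
  refine ⟨r * 2 ^ p, ⟨by positivity, ?_⟩, ?_⟩
  · rw [Real.rpow_add two_pos]
    gcongr
  · filter_upwards [hF, eventually_gt_atTop 0] with x hx hx₀
    calc (2 * x) ^ p * F (2 * x) ≤ (2 * x) ^ p * (r * F x) := by gcongr
      _ = r * 2 ^ p * (x ^ p * F x) := by rw [Real.mul_rpow two_pos.le hx₀.le]; ring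

theorem DoublingGT.rpow_mul (h : DoublingGT F a) (p : ℝ) :
    DoublingGT (fun x => x ^ p * F x) (a + p) := by
  obtain ⟨r, hr, hF⟩ := h
  refine ⟨r * 2 ^ p, ?_, ?_⟩
  · rw [Real.rpow_add two_pos]
    gcongr
  · filter_upwards [hF, eventually_gt_atTop 0] with x hx hx₀
    calc r * 2 ^ p * (x ^ p * F x) = (2 * x) ^ p * (r * F x) := by
          rw [Real.mul_rpow two_pos.le hx₀.le]; ring
      _ ≤ (2 * x) ^ p * F (2 * x) := by gcongr

theorem DoublingGT.lt_of_doublingLT {a' : ℝ} (h : DoublingGT F a) (h' : DoublingLT F a')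
    (hF : ∀ x, 0 < F x) : a < a' := by
  obtain ⟨r, hr, hrF⟩ := h
  obtain ⟨r', ⟨-, hr'⟩, hrF'⟩ := h'
  obtain ⟨x, hx, hx'⟩ := (hrF.and hrF').exists
  have hrr' : r ≤ r' := le_of_mul_le_mul_right (hx.trans hx') (hF x)
  exact (Real.rpow_lt_rpow_left_iff one_lt_two).1 (hr.trans_le hrr' |>.trans hr')

theorem DoublingGT.exists_mul_le_two_pow_mul (h : DoublingGT F a) (n : ℕ) :
    ∃ c > 0, ∀ᶠ x in atTop, c * F x ≤ F (2 ^ n * x) := by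
  obtain ⟨r, hr, hF⟩ := h
  have hr₀ : 0 < r := (Real.rpow_pos_of_pos two_pos a).trans hr
  refine ⟨r ^ n, by positivity, ?_⟩
  induction n with
  | zero => simp
  | succ n ih =>
    have hscale : Tendsto (fun x : ℝ => 2 ^ n * x) atTop atTop :=
      tendsto_id.const_mul_atTop (by positivity)
    filter_upwards [ih, hscale.eventually hF] with x hx hx'
    calc r ^ (n + 1) * F x = r * (r ^ n * F x) := by ring
      _ ≤ r * F (2 ^ n * x) := by gcongr
      _ ≤ F (2 * (2 ^ n * x)) := hx'
      _ = F (2 ^ (n + 1) * x) := by ring_nf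

theorem DoublingGT.exists_mul_le_comp_mul (h : DoublingGT F a) (hF : Antitone F) (A : ℝ) :
    ∃ c > 0, ∀ᶠ x in atTop, c * F x ≤ F (A * x) := by
  obtain ⟨n, hn⟩ := pow_unbounded_of_one_lt A one_lt_two
  obtain ⟨c, hc, hcF⟩ := h.exists_mul_le_two_pow_mul n
  refine ⟨c, hc, ?_⟩
  filter_upwards [hcF, eventually_gt_atTop 0] with x hx hx₀
  exact hx.trans (hF (by gcongr))

theorem SlowlyVarying.tendsto_ratio {L : ℝ → ℝ} (hL : SlowlyVarying L)
    (hF : ∀ x, 0 < x → F x = x ^ a * L x) {c : ℝ} (hc : 0 < c) :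
    Tendsto (fun x => F (c * x) / F x) atTop (𝓝 (c ^ a)) := by
  have hlim := (hL.2.2 c hc).const_mul (c ^ a)
  rw [mul_one] at hlim
  refine hlim.congr' ?_
  filter_upwards [eventually_gt_atTop 0] with x hx
  have hxa : x ^ a ≠ 0 := by positivity
  rw [hF x hx, hF _ (by positivity), Real.mul_rpow hc.le hx.le]
  field_simp

theorem SlowlyVarying.doublingLT {L : ℝ → ℝ} (hL : SlowlyVarying L)
    (hF : ∀ x, 0 < x → F x = x ^ a * L x) (hF₀ : ∀ x, 0 < F x) {a' : ℝ} (ha : a < a') :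
    DoublingLT F a' := by
  obtain ⟨r, har, hra'⟩ := exists_between (Real.rpow_lt_rpow_of_exponent_lt one_lt_two ha)
  refine ⟨r, ⟨(Real.rpow_pos_of_pos two_pos a).trans har, hra'⟩, ?_⟩
  filter_upwards [(hL.tendsto_ratio hF two_pos).eventually_lt_const har] with x hx
  exact ((div_lt_iff₀ (hF₀ x)).1 hx).le

theorem SlowlyVarying.doublingGT {L : ℝ → ℝ} (hL : SlowlyVarying L)
    (hF : ∀ x, 0 < x → F x = x ^ a * L x) (hF₀ : ∀ x, 0 < F x) {a' : ℝ} (ha : a' < a) :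
    DoublingGT F a' := by
  obtain ⟨r, ha'r, hra⟩ := exists_between (Real.rpow_lt_rpow_of_exponent_lt one_lt_two ha)
  refine ⟨r, ha'r, ?_⟩
  filter_upwards [(hL.tendsto_ratio hF two_pos).eventually_const_lt hra] with x hx
  exact ((lt_div_iff₀ (hF₀ x)).1 hx).le

theorem SlowlyVarying.pos_of_antitone {L : ℝ → ℝ} (hL : SlowlyVarying L)
    (hF : ∀ x, 0 < x → F x = x ^ a * L x) (hanti : Antitone F) (x : ℝ) : 0 < F x := by
  obtain ⟨y, hLy, hy, hxy⟩ :=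
    (hL.2.1.and ((eventually_gt_atTop 0).and (eventually_ge_atTop x))).exists
  refine lt_of_lt_of_le ?_ (hanti hxy)
  rw [hF y hy]
  positivity

end Doubling

section DyadicSums

open scoped ENNReal

variable {m : Measure ℝ} {g G : ℝ → ℝ≥0∞} {A q K : ℝ≥0∞} {X x : ℝ}

theorem lintegral_Ioi_le_of_dyadic (hx : 0 < x) (hG : ∀ y ≥ x, G (2 * y) ≤ q * G y)
    (hg : ∀ y ≥ x, ∫⁻ s in Set.Ioc y (2 * y), g s ∂m ≤ A * G y) :
    ∫⁻ s in Set.Ioi x, g s ∂m ≤ A * (1 - q)⁻¹ * G x := by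
  have hle (k : ℕ) : x ≤ 2 ^ k * x := le_mul_of_one_le_left hx.le (one_le_pow₀ one_le_two)
  have hGk (k : ℕ) : G (2 ^ k * x) ≤ q ^ k * G x := by
    induction k with
    | zero => simp
    | succ k ih =>
      calc G (2 ^ (k + 1) * x) = G (2 * (2 ^ k * x)) := by ring_nf
        _ ≤ q * (q ^ k * G x) := (hG _ (hle k)).trans (by gcongr)
        _ = q ^ (k + 1) * G x := by ring
  have hcover : ⋃ k : ℕ, Set.Ioc (2 ^ k * x) (2 * (2 ^ k * x)) = Set.Ioi x := by
    have hunbdd : ¬BddAbove (Set.range fun k : ℕ => 2 ^ k * x) :=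
      not_bddAbove_of_tendsto_atTop
        ((tendsto_pow_atTop_atTop_of_one_lt one_lt_two).atTop_mul_const hx)
    simpa [pow_succ', mul_assoc] using
      iUnion_Ioc_map_succ_eq_Ioi (fun k => by simpa using hle k) hunbdd
  calc ∫⁻ s in Set.Ioi x, g s ∂m
      ≤ ∑' k : ℕ, ∫⁻ s in Set.Ioc (2 ^ k * x) (2 * (2 ^ k * x)), g s ∂m :=
        hcover ▸ lintegral_iUnion_le _ _
    _ ≤ ∑' k : ℕ, A * G x * q ^ k := by
        refine ENNReal.tsum_le_tsum fun k => (hg _ (hle k)).trans ?_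
        calc A * G (2 ^ k * x) ≤ A * (q ^ k * G x) := by gcongr; exact hGk k
          _ = A * G x * q ^ k := by ring
    _ = A * (1 - q)⁻¹ * G x := by rw [ENNReal.tsum_mul_left, ENNReal.tsum_geometric]; ring

theorem lintegral_Ioc_le_of_dyadic (hX : 0 < X) (hG : ∀ y ≥ X, q * G y ≤ G (2 * y))
    (hg : ∀ y ≥ X, ∫⁻ s in Set.Ioc y (2 * y), g s ∂m ≤ A * G y)
    (hbase : ∀ y ∈ Set.Icc X (2 * X), ∫⁻ s in Set.Ioc 0 y, g s ∂m ≤ K * G y)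
    (hK : K + A ≤ K * q) (hx : X ≤ x) : ∫⁻ s in Set.Ioc 0 x, g s ∂m ≤ K * G x := by
  have hblock (n : ℕ) : ∀ y ∈ Set.Icc X (2 ^ n * (2 * X)),
      ∫⁻ s in Set.Ioc 0 y, g s ∂m ≤ K * G y := by
    induction n with
    | zero => simpa using hbase
    | succ n ih =>
      intro y ⟨hXy, hy⟩
      rcases le_total y (2 * X) with hy₂ | hy₂
      · exact hbase y ⟨hXy, hy₂⟩
      obtain ⟨z, rfl⟩ : ∃ z, y = 2 * z := ⟨y / 2, by ring⟩
      have hz : z ∈ Set.Icc X (2 ^ n * (2 * X)) := ⟨by linarith, by rw [pow_succ] at hy; linarith⟩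
      have hz₀ : 0 ≤ z := hX.le.trans hz.1
      rw [← Set.Ioc_union_Ioc_eq_Ioc hz₀ (by linarith)]
      calc ∫⁻ s in Set.Ioc 0 z ∪ Set.Ioc z (2 * z), g s ∂m
          ≤ K * G z + A * G z := (lintegral_union_le _ _ _).trans (add_le_add (ih z hz) (hg z hz.1))
        _ = (K + A) * G z := by ring
        _ ≤ K * (q * G z) := by rw [← mul_assoc]; gcongr
        _ ≤ K * G (2 * z) := by gcongr; exact hG z hz.1
  obtain ⟨n, hn⟩ := pow_unbounded_of_one_lt (x / (2 * X)) one_lt_two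
  exact hblock n x ⟨hx, ((div_lt_iff₀ (by positivity)).1 hn).le⟩

end DyadicSums

section Karamata

open scoped ENNReal

variable {F G : ℝ → ℝ} {A p x : ℝ} {ν : Measure ℝ} [IsFiniteMeasure ν]

theorem DoublingLT.exists_lintegral_Ioi_le {m : Measure ℝ} {g : ℝ → ℝ≥0∞} (h : DoublingLT G 0)
    (hA : 0 < A)
    (hg : ∀ᶠ y in atTop, ∫⁻ s in Set.Ioc y (2 * y), g s ∂m ≤ ENNReal.ofReal (A * G y)) :
    ∃ C > 0, ∀ᶠ x in atTop, ∫⁻ s in Set.Ioi x, g s ∂m ≤ ENNReal.ofReal (C * G x) := by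
  obtain ⟨r, ⟨hr₀, hr₁⟩, hG⟩ := h
  rw [Real.rpow_zero] at hr₁
  obtain ⟨X, hX⟩ := eventually_atTop.1 (hG.and hg)
  have hr₁' : 0 < 1 - r := sub_pos.2 hr₁
  refine ⟨A * (1 - r)⁻¹, by positivity, ?_⟩
  filter_upwards [eventually_ge_atTop X, eventually_gt_atTop 0] with x hx hx₀
  refine (lintegral_Ioi_le_of_dyadic (A := ENNReal.ofReal A) (q := ENNReal.ofReal r)
    (G := fun y => ENNReal.ofReal (G y)) hx₀ (fun y hy => ?_) (fun y hy => ?_)).trans_eq ?_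
  · rw [← ENNReal.ofReal_mul hr₀.le]
    exact ENNReal.ofReal_le_ofReal (hX y (hx.trans hy)).1
  · rw [← ENNReal.ofReal_mul hA.le]
    exact (hX y (hx.trans hy)).2
  · rw [ENNReal.ofReal_mul (by positivity), ENNReal.ofReal_mul hA.le,
      ENNReal.ofReal_inv_of_pos hr₁', ENNReal.ofReal_sub _ hr₀.le, ENNReal.ofReal_one]

theorem DoublingGT.exists_lintegral_Ioc_le {m : Measure ℝ} {g : ℝ → ℝ≥0∞} (h : DoublingGT G 0)
    (hA : 0 < A)
    (hg : ∀ᶠ y in atTop, ∫⁻ s in Set.Ioc y (2 * y), g s ∂m ≤ ENNReal.ofReal (A * G y))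
    (hbase : ∀ X > 0, ∃ K ≥ 0, ∀ y ∈ Set.Icc X (2 * X),
      ∫⁻ s in Set.Ioc 0 y, g s ∂m ≤ ENNReal.ofReal (K * G y)) :
    ∃ C > 0, ∀ᶠ x in atTop, ∫⁻ s in Set.Ioc 0 x, g s ∂m ≤ ENNReal.ofReal (C * G x) := by
  obtain ⟨r, hr, hG⟩ := h
  rw [Real.rpow_zero] at hr
  obtain ⟨X, hX⟩ := eventually_atTop.1 (hG.and (hg.and (eventually_gt_atTop 0)))
  have hX₀ : 0 < X := (hX X le_rfl).2.2
  obtain ⟨K, hK₀, hK⟩ := hbase X hX₀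
  have hr₁ : 0 < r - 1 := sub_pos.2 hr
  have hKA : K ≤ K + A / (r - 1) := le_add_of_nonneg_right (by positivity)
  refine ⟨K + A / (r - 1), by positivity, ?_⟩
  filter_upwards [eventually_ge_atTop X] with x hx
  rw [ENNReal.ofReal_mul (by positivity)]
  refine lintegral_Ioc_le_of_dyadic (A := ENNReal.ofReal A) (q := ENNReal.ofReal r)
    (G := fun y => ENNReal.ofReal (G y)) hX₀ (fun y hy => ?_) (fun y hy => ?_) (fun y hy => ?_)
    ?_ hx
  · rw [← ENNReal.ofReal_mul (by linarith)]
    exact ENNReal.ofReal_le_ofReal (hX y hy).1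
  · rw [← ENNReal.ofReal_mul hA.le]
    exact (hX y hy).2.1
  · refine (hK y hy).trans ?_
    rw [ENNReal.ofReal_mul hK₀]
    gcongr
  · rw [← ENNReal.ofReal_add (by positivity) hA.le, ← ENNReal.ofReal_mul (by positivity)]
    refine ENNReal.ofReal_le_ofReal ?_
    have hA_le : A ≤ (K + A / (r - 1)) * (r - 1) := by
      rw [← div_le_iff₀ hr₁]
      exact le_add_of_nonneg_left hK₀
    linarith

theorem lintegral_rpow_Ioc_two_mul_le (hp : 0 ≤ p) (hx : 0 ≤ x) :
    ∫⁻ s in Set.Ioc x (2 * x), ENNReal.ofReal (s ^ p) ∂ν ≤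
      ENNReal.ofReal (2 ^ p * (x ^ p * ν.real (Set.Ioi x))) := by
  calc ∫⁻ s in Set.Ioc x (2 * x), ENNReal.ofReal (s ^ p) ∂ν
      ≤ ∫⁻ _ in Set.Ioc x (2 * x), ENNReal.ofReal ((2 * x) ^ p) ∂ν :=
        setLIntegral_mono measurable_const fun s hs =>
          ENNReal.ofReal_le_ofReal (Real.rpow_le_rpow (hx.trans hs.1.le) hs.2 hp)
    _ ≤ ENNReal.ofReal ((2 * x) ^ p) * ν (Set.Ioi x) := by
        rw [setLIntegral_const]
        gcongr
        exact Set.Ioc_subset_Ioi_self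
    _ = ENNReal.ofReal (2 ^ p * (x ^ p * ν.real (Set.Ioi x))) := by
        rw [Real.mul_rpow two_pos.le hx, ← mul_assoc, ENNReal.ofReal_mul (p := 2 ^ p * x ^ p)
          (by positivity), ofReal_measureReal]

theorem DoublingLT.exists_lintegral_rpow_Ioi_le (hp : 0 ≤ p)
    (h : DoublingLT (fun x => ν.real (Set.Ioi x)) (-p)) :
    ∃ C > 0, ∀ᶠ x in atTop, ∫⁻ s in Set.Ioi x, ENNReal.ofReal (s ^ p) ∂ν ≤
      ENNReal.ofReal (C * (x ^ p * ν.real (Set.Ioi x))) := by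
  have h₀ := h.rpow_mul p
  rw [neg_add_cancel] at h₀
  refine h₀.exists_lintegral_Ioi_le (A := 2 ^ p) (by positivity) ?_
  filter_upwards [eventually_ge_atTop 0] with y hy using lintegral_rpow_Ioc_two_mul_le hp hy

theorem lintegral_rpow_Ioc_zero_le (hp : 0 ≤ p) :
    ∫⁻ s in Set.Ioc 0 x, ENNReal.ofReal (s ^ p) ∂ν ≤
      ENNReal.ofReal (x ^ p * ν.real (Set.Ioi 0)) := by
  rcases le_or_gt x 0 with hx | hx
  · simp [Set.Ioc_eq_empty_of_le hx]
  calc ∫⁻ s in Set.Ioc 0 x, ENNReal.ofReal (s ^ p) ∂ν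
      ≤ ∫⁻ _ in Set.Ioc 0 x, ENNReal.ofReal (x ^ p) ∂ν :=
        setLIntegral_mono measurable_const fun s hs =>
          ENNReal.ofReal_le_ofReal (Real.rpow_le_rpow hs.1.le hs.2 hp)
    _ ≤ ENNReal.ofReal (x ^ p) * ν (Set.Ioi 0) := by
        rw [setLIntegral_const]
        gcongr
        exact Set.Ioc_subset_Ioi_self
    _ = ENNReal.ofReal (x ^ p * ν.real (Set.Ioi 0)) := by
        rw [ENNReal.ofReal_mul (by positivity), ofReal_measureReal]

theorem antitone_measureReal_Ioi : Antitone fun x => ν.real (Set.Ioi x) :=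
  fun _ _ hxy => measureReal_mono (Set.Ioi_subset_Ioi hxy)

theorem DoublingGT.exists_lintegral_rpow_Ioc_le (hp : 0 ≤ p)
    (h : DoublingGT (fun x => ν.real (Set.Ioi x)) (-p)) (hν : ∀ x, 0 < ν.real (Set.Ioi x)) :
    ∃ C > 0, ∀ᶠ x in atTop, ∫⁻ s in Set.Ioc 0 x, ENNReal.ofReal (s ^ p) ∂ν ≤
      ENNReal.ofReal (C * (x ^ p * ν.real (Set.Ioi x))) := by
  have h₀ := h.rpow_mul p
  rw [neg_add_cancel] at h₀
  refine h₀.exists_lintegral_Ioc_le (A := 2 ^ p) (by positivity) ?_ fun X hX => ?_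
  · filter_upwards [eventually_ge_atTop 0] with y hy using lintegral_rpow_Ioc_two_mul_le hp hy
  have hνX : 0 < ν.real (Set.Ioi (2 * X)) := hν _
  refine ⟨ν.real (Set.Ioi 0) / ν.real (Set.Ioi (2 * X)), by positivity, fun y hy => ?_⟩
  refine (lintegral_rpow_Ioc_zero_le hp).trans (ENNReal.ofReal_le_ofReal ?_)
  have hy₀ : 0 ≤ y := hX.le.trans hy.1
  calc y ^ p * ν.real (Set.Ioi 0)
      = ν.real (Set.Ioi 0) / ν.real (Set.Ioi (2 * X)) * (y ^ p * ν.real (Set.Ioi (2 * X))) := by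
        field_simp
    _ ≤ ν.real (Set.Ioi 0) / ν.real (Set.Ioi (2 * X)) * (y ^ p * ν.real (Set.Ioi y)) := by
        gcongr ?_ * (_ * ?_)
        exact antitone_measureReal_Ioi hy.2

theorem DoublingLT.exists_lintegral_rpow_mul_Ioi_le (hF : Antitone F) (hF₀ : ∀ x, 0 ≤ F x)
    (hp : 0 ≤ p) (h : DoublingLT F (-(p + 1))) :
    ∃ C > 0, ∀ᶠ x in atTop, ∫⁻ y in Set.Ioi x, ENNReal.ofReal (y ^ p * F y) ≤
      ENNReal.ofReal (C * (x ^ (p + 1) * F x)) := by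
  have h₀ := h.rpow_mul (p + 1)
  rw [neg_add_cancel] at h₀
  refine h₀.exists_lintegral_Ioi_le (A := 2 ^ p) (by positivity) ?_
  filter_upwards [eventually_gt_atTop 0] with x hx
  calc ∫⁻ y in Set.Ioc x (2 * x), ENNReal.ofReal (y ^ p * F y)
      ≤ ∫⁻ _ in Set.Ioc x (2 * x), ENNReal.ofReal ((2 * x) ^ p * F x) :=
        setLIntegral_mono measurable_const fun y hy => by
          have hy₀ : 0 ≤ y := hx.le.trans hy.1.le
          gcongr
          exacts [hF₀ y, hy.2, hF hy.1.le]
    _ = ENNReal.ofReal (2 ^ p * (x ^ (p + 1) * F x)) := by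
        rw [setLIntegral_const, Real.volume_Ioc, ← ENNReal.ofReal_mul
          (mul_nonneg (by positivity) (hF₀ x)), Real.mul_rpow two_pos.le hx.le,
          Real.rpow_add_one hx.ne']
        ring_nf

theorem DoublingLT.integrableOn_rpow (hp : 0 ≤ p)
    (h : DoublingLT (fun x => ν.real (Set.Ioi x)) (-p)) :
    IntegrableOn (fun s => s ^ p) (Set.Ioi 0) ν := by
  obtain ⟨C, -, hC⟩ := h.exists_lintegral_rpow_Ioi_le hp
  obtain ⟨x, hx, hx₀⟩ := (hC.and (eventually_ge_atTop 0)).exists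
  have hfin : ∫⁻ s in Set.Ioi 0, ENNReal.ofReal (s ^ p) ∂ν < ∞ := by
    rw [← Set.Ioc_union_Ioi_eq_Ioi hx₀]
    exact (lintegral_union_le _ _ _).trans_lt (ENNReal.add_lt_top.2
      ⟨(lintegral_rpow_Ioc_zero_le hp).trans_lt ENNReal.ofReal_lt_top,
        hx.trans_lt ENNReal.ofReal_lt_top⟩)
  refine ⟨by fun_prop, (hasFiniteIntegral_iff_ofReal ?_).2 hfin⟩
  filter_upwards [ae_restrict_mem measurableSet_Ioi] with s (hs : 0 < s)
  positivity

theorem measureReal_map_Ioi {Ω : Type*} [MeasurableSpace Ω] {μ : Measure Ω} {X : Ω → ℝ}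
    (hX : AEMeasurable X μ) (x : ℝ) :
    (μ.map X).real (Set.Ioi x) = μ.real {ω | x < X ω} :=
  map_measureReal_apply_of_aemeasurable hX measurableSet_Ioi

theorem DoublingLT.memLp {Ω : Type*} [MeasurableSpace Ω] {μ : Measure Ω} [IsFiniteMeasure μ]
    {X : Ω → ℝ} (hX : AEMeasurable X μ) (hX₀ : 0 ≤ᵐ[μ] X) (hp : 0 < p)
    (h : DoublingLT (fun x => μ.real {ω | x < X ω}) (-p)) :
    MemLp X (ENNReal.ofReal p) μ := by
  simp only [← measureReal_map_Ioi hX] at h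
  have hpos : IntegrableOn (fun ω => X ω ^ p) {ω | 0 < X ω} μ := by
    have hνint := h.integrableOn_rpow hp.le
    rw [IntegrableOn, Measure.restrict_map_of_aemeasurable hX measurableSet_Ioi] at hνint
    exact hνint.comp_aemeasurable hX.restrict
  have hset : NullMeasurableSet {ω | 0 < X ω} μ := nullMeasurableSet_lt aemeasurable_const hX
  have hint : Integrable (fun ω => ‖X ω‖ ^ p) μ := by
    refine (hpos.integrable_indicator₀ hset).congr ?_
    filter_upwards [hX₀] with ω (hω : 0 ≤ X ω)
    rcases hω.eq_or_lt with hω₀ | hω₀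
    · simp [← hω₀, hp.ne']
    · simp [hω₀, abs_of_pos]
  have hp₀ : ENNReal.ofReal p ≠ 0 := (ENNReal.ofReal_pos.2 hp).ne'
  refine (integrable_norm_rpow_iff hX.aestronglyMeasurable hp₀ ENNReal.ofReal_ne_top).1 ?_
  rwa [ENNReal.toReal_ofReal hp.le]

theorem DoublingLT.integrableOn_id_mul (hF : Antitone F) (hF₀ : ∀ x, 0 ≤ F x)
    (h : DoublingLT F (-2)) : IntegrableOn (fun y => y * F y) (Set.Ioi 0) := by
  have h' : DoublingLT F (-(1 + 1)) := by norm_num [h]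
  obtain ⟨C, -, hC⟩ := h'.exists_lintegral_rpow_mul_Ioi_le hF hF₀ zero_le_one
  obtain ⟨x, hx, hx₀⟩ := (hC.and (eventually_ge_atTop 0)).exists
  have hmeas : Measurable fun y => y * F y := measurable_id.mul hF.measurable
  have hIoc : IntegrableOn (fun y => y * F y) (Set.Ioc 0 x) := by
    refine Measure.integrableOn_of_bounded (M := x * F 0) (by simp) hmeas.aestronglyMeasurable ?_
    filter_upwards [ae_restrict_mem measurableSet_Ioc] with y hy
    rw [Real.norm_of_nonneg (mul_nonneg hy.1.le (hF₀ y))]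
    exact mul_le_mul hy.2 (hF hy.1.le) (hF₀ y) hx₀
  have hIoi : IntegrableOn (fun y => y * F y) (Set.Ioi x) := by
    refine ⟨hmeas.aestronglyMeasurable, (hasFiniteIntegral_iff_ofReal ?_).2 ?_⟩
    · filter_upwards [ae_restrict_mem measurableSet_Ioi] with y hy
      exact mul_nonneg (hx₀.trans hy.le) (hF₀ y)
    · simpa only [Real.rpow_one] using hx.trans_lt ENNReal.ofReal_lt_top
  rw [← Set.Ioc_union_Ioi_eq_Ioi hx₀]
  exact hIoc.union hIoi

theorem DoublingLT.exists_setIntegral_id_mul_le (hF : Antitone F) (hF₀ : ∀ x, 0 ≤ F x)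
    (h : DoublingLT F (-2)) :
    ∃ C > 0, ∀ᶠ x in atTop, ∫ y in Set.Ioi x, y * F y ≤ C * (x ^ 2 * F x) := by
  have h' : DoublingLT F (-(1 + 1)) := by norm_num [h]
  obtain ⟨C, hC₀, hC⟩ := h'.exists_lintegral_rpow_mul_Ioi_le hF hF₀ zero_le_one
  refine ⟨C, hC₀, ?_⟩
  filter_upwards [hC, eventually_ge_atTop 0] with x hx hx₀
  have hFx := hF₀ x
  rw [integral_eq_lintegral_of_nonneg_ae]
  · refine ENNReal.toReal_le_of_le_ofReal (by positivity) ?_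
    simpa only [Real.rpow_one, one_add_one_eq_two, Real.rpow_two] using hx
  · filter_upwards [ae_restrict_mem measurableSet_Ioi] with y hy
    exact mul_nonneg (hx₀.trans hy.le) (hF₀ y)
  · exact (measurable_id.mul hF.measurable).aestronglyMeasurable

theorem DoublingGT.exists_le_setIntegral_id_mul {a : ℝ} (hF : Antitone F) (hF₀ : ∀ x, 0 ≤ F x)
    (hint : IntegrableOn (fun y => y * F y) (Set.Ioi 0)) (h : DoublingGT F a) :
    ∃ c > 0, ∀ᶠ x in atTop, c * (x ^ 2 * F x) ≤ ∫ y in Set.Ioi x, y * F y := by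
  obtain ⟨c, hc, hcF⟩ := h.exists_mul_le_comp_mul hF 2
  refine ⟨c, hc, ?_⟩
  filter_upwards [hcF, eventually_ge_atTop 0] with x hx hx₀
  have hint' : IntegrableOn (fun y => y * F y) (Set.Ioi x) :=
    hint.mono_set (Set.Ioi_subset_Ioi hx₀)
  calc c * (x ^ 2 * F x) ≤ x ^ 2 * F (2 * x) := by rw [mul_left_comm]; gcongr
    _ = ∫ _ in Set.Ioc x (2 * x), x * F (2 * x) := by
        rw [setIntegral_const, Real.volume_real_Ioc_of_le (by linarith), smul_eq_mul]
        ring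
    _ ≤ ∫ y in Set.Ioc x (2 * x), y * F y := by
        refine setIntegral_mono_on (integrableOn_const (by simp))
          (hint'.mono_set Set.Ioc_subset_Ioi_self) measurableSet_Ioc fun y hy => ?_
        exact mul_le_mul hy.1.le (hF hy.2) (hF₀ _) (hx₀.trans hy.1.le)
    _ ≤ ∫ y in Set.Ioi x, y * F y := by
        refine setIntegral_mono_set hint' ?_ Set.Ioc_subset_Ioi_self.eventuallyLE
        filter_upwards [ae_restrict_mem measurableSet_Ioi] with y hy
        exact mul_nonneg (hx₀.trans hy.le) (hF₀ y)

end Karamata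

section LyapunovKernel

/-- The kernel `s ^ (2 + b) / (x ^ 2 + s ^ 2) ^ (b / 2)`, which interpolates smoothly between
`s ^ 2` for `s ≥ x` and `s ^ (2 + b) * x ^ (-b)` for `s ≤ x`. -/
noncomputable def mixKernel (b x s : ℝ) : ℝ := s ^ (2 + b) * (x ^ 2 + s ^ 2) ^ (-(b / 2))

variable {b x y s κ : ℝ}

theorem mixKernel_pos (b x : ℝ) (hs : 0 < s) : 0 < mixKernel b x s := by
  unfold mixKernel
  positivity

theorem mixKernel_le_sq (hb : 0 ≤ b) (x : ℝ) (hs : 0 < s) : mixKernel b x s ≤ s ^ 2 := by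
  calc s ^ (2 + b) * (x ^ 2 + s ^ 2) ^ (-(b / 2)) ≤ s ^ (2 + b) * (s ^ 2) ^ (-(b / 2)) := by
        gcongr ?_ * ?_
        exact Real.rpow_le_rpow_of_nonpos (by positivity) (le_add_of_nonneg_left (sq_nonneg x))
          (by linarith)
    _ = s ^ 2 := by
        rw [← Real.rpow_natCast_mul hs.le, ← Real.rpow_add hs, ← Real.rpow_two]
        congr 1
        push_cast
        ring

theorem mixKernel_le_rpow (hb : 0 ≤ b) (hx : 0 < x) (hs : 0 < s) :
    mixKernel b x s ≤ s ^ (2 + b) * x ^ (-b) := by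
  calc s ^ (2 + b) * (x ^ 2 + s ^ 2) ^ (-(b / 2)) ≤ s ^ (2 + b) * (x ^ 2) ^ (-(b / 2)) := by
        gcongr ?_ * ?_
        exact Real.rpow_le_rpow_of_nonpos (by positivity) (le_add_of_nonneg_right (sq_nonneg s))
          (by linarith)
    _ = s ^ (2 + b) * x ^ (-b) := by
        rw [← Real.rpow_natCast_mul hx.le]
        congr 2
        push_cast
        ring

theorem mixKernel_antitoneOn (hb : 0 ≤ b) (hs : 0 < s) :
    AntitoneOn (fun x => mixKernel b x s) (Set.Ici 0) := by
  intro x hx y _ hxy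
  have hx₀ : 0 ≤ x := hx
  dsimp only [mixKernel]
  gcongr ?_ * ?_
  exact Real.rpow_le_rpow_of_nonpos (by positivity) (by gcongr) (by linarith)

theorem le_div_mul_mixKernel (hb : 0 ≤ b) (hx : 0 < x) (hxs : x ≤ s) :
    b * 2 ^ (-(b / 2) - 1) ≤ b / (x ^ 2 + s ^ 2) * mixKernel b x s := by
  have hs : 0 < s := hx.trans_le hxs
  have hw : x ^ 2 + s ^ 2 ≤ 2 * s ^ 2 := by nlinarith
  have hpow : (2 * s ^ 2) ^ (-(b / 2) - 1) ≤ (x ^ 2 + s ^ 2) ^ (-(b / 2) - 1) :=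
    Real.rpow_le_rpow_of_nonpos (by positivity) hw (by linarith)
  calc b * 2 ^ (-(b / 2) - 1) = b * s ^ (2 + b) * (2 * s ^ 2) ^ (-(b / 2) - 1) := by
        have hcancel : s ^ (2 + b) * (s ^ 2) ^ (-(b / 2) - 1) = 1 := by
          rw [← Real.rpow_natCast_mul hs.le, ← Real.rpow_add hs]
          convert Real.rpow_zero s using 2
          push_cast
          ring
        rw [Real.mul_rpow two_pos.le (by positivity), mul_mul_mul_comm, hcancel, mul_one]
    _ ≤ b * s ^ (2 + b) * (x ^ 2 + s ^ 2) ^ (-(b / 2) - 1) := by gcongr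
    _ = b / (x ^ 2 + s ^ 2) * mixKernel b x s := by
        rw [Real.rpow_sub_one (by positivity), mixKernel]
        ring

theorem measurable_mixKernel (b : ℝ) : Measurable fun z : ℝ × ℝ => mixKernel b z.1 z.2 := by
  unfold mixKernel
  fun_prop

theorem tendsto_mixKernel_atTop (hb : 0 < b) (hs : 0 < s) :
    Tendsto (fun x => mixKernel b x s) atTop (𝓝 0) := by
  have hlim := (tendsto_rpow_neg_atTop hb).const_mul (s ^ (2 + b))
  rw [mul_zero] at hlim
  refine squeeze_zero' (.of_forall fun x => (mixKernel_pos b x hs).le) ?_ hlim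
  filter_upwards [eventually_gt_atTop 0] with x hx using mixKernel_le_rpow hb.le hx hs

theorem eventually_one_add_rpow_le (a : ℝ) {c : ℝ} (hc : a * (a - 1) / 2 < c) :
    ∀ᶠ q : ℝ in 𝓝 0, (1 + q) ^ a ≤ 1 + a * q + c * q ^ 2 := by
  set h : ℝ → ℝ := fun q => 1 + a * q + c * q ^ 2 - (1 + q) ^ a with h_def
  have hderiv (q : ℝ) (hq : -1 < q) :
      HasDerivAt h (a + 2 * c * q - a * (1 + q) ^ (a - 1)) q := by
    have hpow := ((hasDerivAt_id q).const_add 1).rpow_const (p := a)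
      (Or.inl (show 1 + q ≠ 0 by linarith))
    have hquad := (((hasDerivAt_id q).const_mul a).const_add 1).add
      (((hasDerivAt_id q).pow 2).const_mul c)
    refine (hquad.sub hpow).congr_deriv ?_
    simp only [id, Nat.cast_ofNat]
    ring
  have hderiv_eq : deriv h =ᶠ[𝓝 0] fun q => a + 2 * c * q - a * (1 + q) ^ (a - 1) := by
    filter_upwards [lt_mem_nhds (show (-1 : ℝ) < 0 by norm_num)] with q hq using (hderiv q hq).deriv
  have hderiv₂ : HasDerivAt (deriv h) (2 * c - a * (a - 1)) 0 := by
    refine HasDerivAt.congr_of_eventuallyEq ?_ hderiv_eq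
    have hpow := ((hasDerivAt_id (0 : ℝ)).const_add 1).rpow_const (p := a - 1) (Or.inl (by simp))
    refine ((((hasDerivAt_id (0 : ℝ)).const_mul (2 * c)).const_add a).sub
      (hpow.const_mul a)).congr_deriv ?_
    simp
  have hmin : IsLocalMin h 0 := by
    refine isLocalMin_of_deriv_deriv_pos ?_ ?_ (hderiv 0 (by norm_num)).continuousAt
    · rw [hderiv₂.deriv]
      linarith
    · rw [(hderiv 0 (by norm_num)).deriv]
      simp
  filter_upwards [hmin] with q hq
  have h_zero : h 0 = 0 := by simp [h_def]
  rw [h_zero] at hq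
  exact sub_nonneg.1 hq

theorem mul_sq_mul_div_le {c d r u w J : ℝ} (hc : 0 ≤ c) (hr : c * r ^ 2 ≤ d) (hw : 0 < w)
    (hyw : y ^ 2 ≤ w) (hu : |u| ≤ r * y) : c * (u * J / w) ^ 2 ≤ d * J ^ 2 / w := by
  calc c * (u * J / w) ^ 2 = c * |u| ^ 2 * J ^ 2 / w / w := by
        rw [sq_abs]
        field_simp
    _ ≤ c * (r * y) ^ 2 * J ^ 2 / w / w := by gcongr
    _ = c * r ^ 2 * (y ^ 2 / w) * (J ^ 2 / w) := by field_simp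
    _ ≤ d * 1 * (J ^ 2 / w) := by
        have hd : 0 ≤ d := (mul_nonneg hc (sq_nonneg r)).trans hr
        gcongr
        exact (div_le_one hw).2 hyw
    _ = d * J ^ 2 / w := by ring

theorem exists_one_add_div_rpow_le (hb : 0 < b) (hκ : (b + 1) / 2 < κ) :
    ∃ η > 0, ∀ y > 0, ∀ w ≥ y ^ 2, ∀ J : ℝ, |J| ≤ η * y →
      (1 + (2 * y + J) * J / w) ^ (-(b / 2)) ≤ 1 - b / w * (y * J - κ * J ^ 2) := by
  obtain ⟨c, hc, hcκ⟩ : ∃ c, -(b / 2) * (-(b / 2) - 1) / 2 < c ∧ c < b * (κ + 1 / 2) / 4 :=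
    exists_between (by nlinarith)
  have hc₀ : 0 < c := lt_trans (by nlinarith) hc
  obtain ⟨r, hr, hbound⟩ := Metric.eventually_nhds_iff.1 (eventually_one_add_rpow_le _ hc)
  obtain ⟨η, ⟨hηr, hηκ⟩, hη⟩ : ∃ η : ℝ, ((2 + η) * η < r ∧ c * (2 + η) ^ 2 < b * (κ + 1 / 2)) ∧
      0 < η := by
    have h_small : ∀ᶠ η : ℝ in 𝓝 0, (2 + η) * η < r :=
      ContinuousAt.eventually_lt (by fun_prop) continuousAt_const (by simpa using hr)
    have h_coeff : ∀ᶠ η : ℝ in 𝓝 0, c * (2 + η) ^ 2 < b * (κ + 1 / 2) :=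
      ContinuousAt.eventually_lt (by fun_prop) continuousAt_const (by norm_num; linarith)
    exact (((h_small.and h_coeff).filter_mono nhdsWithin_le_nhds).and
      (eventually_mem_nhdsWithin (s := Set.Ioi 0))).exists
  refine ⟨η, hη, fun y hy w hyw J hJ => ?_⟩
  have hw : 0 < w := lt_of_lt_of_le (by positivity) hyw
  have h2yJ : |2 * y + J| ≤ (2 + η) * y := by
    rw [abs_le] at hJ ⊢
    constructor <;> nlinarith [hJ.1, hJ.2]
  have hq : |(2 * y + J) * J / w| < r := by
    refine lt_of_le_of_lt ?_ hηr
    rw [abs_div, abs_mul, abs_of_pos hw, div_le_iff₀ hw]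
    calc |2 * y + J| * |J| ≤ ((2 + η) * y) * (η * y) := by gcongr
      _ = (2 + η) * η * y ^ 2 := by ring
      _ ≤ (2 + η) * η * w := by gcongr
  have hquad := mul_sq_mul_div_le (J := J) hc₀.le hηκ.le hw hyw h2yJ
  calc (1 + (2 * y + J) * J / w) ^ (-(b / 2))
      ≤ 1 + -(b / 2) * ((2 * y + J) * J / w) + c * ((2 * y + J) * J / w) ^ 2 :=
        hbound (by rwa [Real.dist_eq, sub_zero])
    _ ≤ 1 + -(b / 2) * ((2 * y + J) * J / w) + b * (κ + 1 / 2) * J ^ 2 / w := by gcongr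
    _ = 1 - b / w * (y * J - κ * J ^ 2) := by ring

theorem mixKernel_add (b : ℝ) (hy : 0 < y) (J s : ℝ) :
    mixKernel b (y + J) s =
      mixKernel b y s * (1 + (2 * y + J) * J / (y ^ 2 + s ^ 2)) ^ (-(b / 2)) := by
  have hw : 0 < y ^ 2 + s ^ 2 := by positivity
  have hq : 1 + (2 * y + J) * J / (y ^ 2 + s ^ 2) = ((y + J) ^ 2 + s ^ 2) / (y ^ 2 + s ^ 2) := by
    field_simp
    ring
  rw [hq, Real.div_rpow (by positivity) hw.le]
  unfold mixKernel
  field_simp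

theorem exists_mixKernel_add_le (hb : 0 < b) (hκ : (b + 1) / 2 < κ) :
    ∃ η > 0, ∀ y > 0, ∀ s > 0, ∀ J : ℝ, |J| ≤ η * y →
      mixKernel b (y + J) s ≤
        mixKernel b y s - b / (y ^ 2 + s ^ 2) * mixKernel b y s * (y * J - κ * J ^ 2) := by
  obtain ⟨η, hη, hbound⟩ := exists_one_add_div_rpow_le hb hκ
  refine ⟨η, hη, fun y hy s hs J hJ => ?_⟩
  calc mixKernel b (y + J) s
      = mixKernel b y s * (1 + (2 * y + J) * J / (y ^ 2 + s ^ 2)) ^ (-(b / 2)) :=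
        mixKernel_add b hy J s
    _ ≤ mixKernel b y s * (1 - b / (y ^ 2 + s ^ 2) * (y * J - κ * J ^ 2)) := by
        gcongr
        · exact (mixKernel_pos b y hs).le
        · exact hbound y hy _ (le_add_of_nonneg_right (sq_nonneg s)) J hJ
    _ = _ := by ring

end LyapunovKernel

section Lyapunov

variable {ν : Measure ℝ} {b x y κ : ℝ}

/-- The Lyapunov function `∫ s ^ (2 + b) / (x ^ 2 + s ^ 2) ^ (b / 2) ν(ds)`, of the order of
`x ^ 2 * ν (x, ∞)` when this function of `x` decays more slowly than `x ^ (-b)`. -/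
noncomputable def lyapunov (ν : Measure ℝ) (b x : ℝ) : ℝ := ∫ s in Set.Ioi 0, mixKernel b x s ∂ν

/-- The rate `∫ b / (x ^ 2 + s ^ 2) * mixKernel b x s ν(ds)` at which `lyapunov ν b` decreases at
`x`: a jump from `x` to `x + J` with small `J / x` decreases it by at least `x * J - κ * J ^ 2`
times this quantity. -/
noncomputable def lyapunovRate (ν : Measure ℝ) (b x : ℝ) : ℝ :=
  ∫ s in Set.Ioi 0, b / (x ^ 2 + s ^ 2) * mixKernel b x s ∂ν

theorem integrable_mixKernel (hb : 0 ≤ b) (hν : IntegrableOn (fun s => s ^ 2) (Set.Ioi 0) ν)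
    (x : ℝ) : IntegrableOn (mixKernel b x) (Set.Ioi 0) ν := by
  refine hν.mono' ((measurable_mixKernel b).of_uncurry_left (x := x)).aestronglyMeasurable ?_
  filter_upwards [ae_restrict_mem measurableSet_Ioi] with s (hs : 0 < s)
  rw [Real.norm_of_nonneg (mixKernel_pos b x hs).le]
  exact mixKernel_le_sq hb x hs

theorem integrable_div_mul_mixKernel (hb : 0 ≤ b)
    (hν : IntegrableOn (fun s => s ^ 2) (Set.Ioi 0) ν) (hx : 0 < x) :
    IntegrableOn (fun s => b / (x ^ 2 + s ^ 2) * mixKernel b x s) (Set.Ioi 0) ν := by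
  refine (integrable_mixKernel hb hν x).bdd_mul (c := b / x ^ 2)
    (Measurable.aestronglyMeasurable (by fun_prop)) (.of_forall fun s => ?_)
  rw [Real.norm_of_nonneg (by positivity)]
  gcongr
  exact le_add_of_nonneg_right (sq_nonneg s)

theorem lyapunov_antitoneOn (hb : 0 ≤ b) (hν : IntegrableOn (fun s => s ^ 2) (Set.Ioi 0) ν) :
    AntitoneOn (lyapunov ν b) (Set.Ici 0) := fun x hx y hy hxy =>
  setIntegral_mono_on (integrable_mixKernel hb hν y) (integrable_mixKernel hb hν x)
    measurableSet_Ioi fun _ hs => mixKernel_antitoneOn hb hs hx hy hxy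

theorem measurable_lyapunov [SFinite ν] (b : ℝ) : Measurable (lyapunov ν b) :=
  (measurable_mixKernel b).stronglyMeasurable.integral_prod_right.measurable

theorem lyapunov_nonneg (ν : Measure ℝ) (b x : ℝ) : 0 ≤ lyapunov ν b x :=
  setIntegral_nonneg measurableSet_Ioi fun _ hs => (mixKernel_pos b x hs).le

theorem lyapunovRate_nonneg (hb : 0 ≤ b) (ν : Measure ℝ) (x : ℝ) : 0 ≤ lyapunovRate ν b x :=
  setIntegral_nonneg measurableSet_Ioi fun _ hs =>
    mul_nonneg (by positivity) (mixKernel_pos b x hs).le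

theorem lyapunov_pos (hb : 0 ≤ b) (hν : IntegrableOn (fun s => s ^ 2) (Set.Ioi 0) ν)
    (hν₀ : 0 < ν.real (Set.Ioi 0)) (x : ℝ) : 0 < lyapunov ν b x := by
  refine (setIntegral_pos_iff_support_of_nonneg_ae ?_ (integrable_mixKernel hb hν x)).2 ?_
  · filter_upwards [ae_restrict_mem measurableSet_Ioi] with s hs using (mixKernel_pos b x hs).le
  · exact (ENNReal.toReal_pos_iff.1 hν₀).1.trans_le
      (measure_mono fun s hs => ⟨(mixKernel_pos b x hs).ne', hs⟩)

theorem tendsto_lyapunov_atTop (hb : 0 < b) (hν : IntegrableOn (fun s => s ^ 2) (Set.Ioi 0) ν) :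
    Tendsto (lyapunov ν b) atTop (𝓝 0) := by
  rw [← integral_zero ℝ ℝ (μ := ν.restrict (Set.Ioi 0))]
  refine tendsto_integral_filter_of_dominated_convergence (fun s => s ^ 2)
    (.of_forall fun x => (integrable_mixKernel hb.le hν x).1) (.of_forall fun x => ?_) hν ?_
  · filter_upwards [ae_restrict_mem measurableSet_Ioi] with s (hs : 0 < s)
    rw [Real.norm_of_nonneg (mixKernel_pos b x hs).le]
    exact mixKernel_le_sq hb.le x hs
  · filter_upwards [ae_restrict_mem measurableSet_Ioi] with s hs using tendsto_mixKernel_atTop hb hs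

theorem exists_lyapunov_le [IsFiniteMeasure ν] (hb : 0 ≤ b)
    (hν₀ : ∀ x, 0 < ν.real (Set.Ioi x))
    (hlt : DoublingLT (fun x => ν.real (Set.Ioi x)) (-2))
    (hgt : DoublingGT (fun x => ν.real (Set.Ioi x)) (-(2 + b))) :
    ∃ C > 0, ∀ᶠ x in atTop, lyapunov ν b x ≤ C * (x ^ 2 * ν.real (Set.Ioi x)) := by
  obtain ⟨C₁, hC₁, h₁⟩ := hgt.exists_lintegral_rpow_Ioc_le (by positivity) hν₀
  obtain ⟨C₂, hC₂, h₂⟩ := hlt.exists_lintegral_rpow_Ioi_le two_pos.le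
  refine ⟨C₁ + C₂, by positivity, ?_⟩
  filter_upwards [h₁, h₂, eventually_gt_atTop 0] with x hx₁ hx₂ hx₀
  have hsmall : ∫⁻ s in Set.Ioc 0 x, ENNReal.ofReal (mixKernel b x s) ∂ν ≤
      ENNReal.ofReal (C₁ * (x ^ 2 * ν.real (Set.Ioi x))) := by
    calc ∫⁻ s in Set.Ioc 0 x, ENNReal.ofReal (mixKernel b x s) ∂ν
        ≤ ∫⁻ s in Set.Ioc 0 x, ENNReal.ofReal (s ^ (2 + b)) * ENNReal.ofReal (x ^ (-b)) ∂ν := by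
          refine setLIntegral_mono (by fun_prop) fun s hs => ?_
          rw [← ENNReal.ofReal_mul (Real.rpow_nonneg hs.1.le _)]
          exact ENNReal.ofReal_le_ofReal (mixKernel_le_rpow hb hx₀ hs.1)
      _ ≤ ENNReal.ofReal (C₁ * (x ^ (2 + b) * ν.real (Set.Ioi x))) * ENNReal.ofReal (x ^ (-b)) := by
          rw [lintegral_mul_const _ (by fun_prop)]
          gcongr
      _ = ENNReal.ofReal (C₁ * (x ^ 2 * ν.real (Set.Ioi x))) := by
          rw [← ENNReal.ofReal_mul (by positivity), Real.rpow_add hx₀, Real.rpow_two,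
            Real.rpow_neg hx₀.le]
          field_simp
  have hlarge : ∫⁻ s in Set.Ioi x, ENNReal.ofReal (mixKernel b x s) ∂ν ≤
      ENNReal.ofReal (C₂ * (x ^ 2 * ν.real (Set.Ioi x))) := by
    rw [← Real.rpow_two]
    refine le_trans (setLIntegral_mono (by fun_prop) fun s hs => ?_) hx₂
    rw [Real.rpow_two]
    exact ENNReal.ofReal_le_ofReal (mixKernel_le_sq hb x (hx₀.trans hs))
  rw [lyapunov, integral_eq_lintegral_of_nonneg_ae]
  · refine ENNReal.toReal_le_of_le_ofReal (by positivity) ?_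
    rw [← Set.Ioc_union_Ioi_eq_Ioi hx₀.le, add_mul,
      ENNReal.ofReal_add (by positivity) (by positivity)]
    exact (lintegral_union_le _ _ _).trans (add_le_add hsmall hlarge)
  · filter_upwards [ae_restrict_mem measurableSet_Ioi] with s hs using (mixKernel_pos b x hs).le
  · exact ((measurable_mixKernel b).of_uncurry_left (x := x)).aestronglyMeasurable

theorem le_lyapunovRate [IsFiniteMeasure ν] (hb : 0 ≤ b)
    (hν : IntegrableOn (fun s => s ^ 2) (Set.Ioi 0) ν) (hx : 0 < x) :
    b * 2 ^ (-(b / 2) - 1) * ν.real (Set.Ioi x) ≤ lyapunovRate ν b x := by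
  have hint := integrable_div_mul_mixKernel hb hν hx
  have hsub : Set.Ioi x ⊆ Set.Ioi 0 := Set.Ioi_subset_Ioi hx.le
  calc b * 2 ^ (-(b / 2) - 1) * ν.real (Set.Ioi x)
      = ∫ _ in Set.Ioi x, b * 2 ^ (-(b / 2) - 1) ∂ν := by
        rw [setIntegral_const, smul_eq_mul, mul_comm]
    _ ≤ ∫ s in Set.Ioi x, b / (x ^ 2 + s ^ 2) * mixKernel b x s ∂ν := by
        refine setIntegral_mono_on (integrableOn_const (by simp)) (hint.mono_set hsub)
          measurableSet_Ioi fun s hs => le_div_mul_mixKernel hb hx (le_of_lt hs)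
    _ ≤ lyapunovRate ν b x := by
        refine setIntegral_mono_set hint ?_ hsub.eventuallyLE
        filter_upwards [ae_restrict_mem measurableSet_Ioi] with s hs
        exact mul_nonneg (by positivity) (mixKernel_pos b x hs).le

theorem exists_lyapunov_add_le (hb : 0 < b) (hν : IntegrableOn (fun s => s ^ 2) (Set.Ioi 0) ν)
    (hκ : (b + 1) / 2 < κ) :
    ∃ η > 0, ∀ y > 0, ∀ J : ℝ, |J| ≤ η * y →
      lyapunov ν b (y + J) ≤ lyapunov ν b y - lyapunovRate ν b y * (y * J - κ * J ^ 2) := by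
  obtain ⟨η, hη, hstep⟩ := exists_mixKernel_add_le hb hκ
  refine ⟨η, hη, fun y hy J hJ => ?_⟩
  have hrate := (integrable_div_mul_mixKernel hb.le hν hy).mul_const (y * J - κ * J ^ 2)
  rw [lyapunovRate, ← integral_mul_const, lyapunov, lyapunov,
    ← integral_sub (integrable_mixKernel hb.le hν y) hrate]
  exact setIntegral_mono_on (integrable_mixKernel hb.le hν _)
    ((integrable_mixKernel hb.le hν y).sub hrate) measurableSet_Ioi fun s hs => hstep y hy s hs J hJ

end Lyapunov

section Drift

/-- The change of the reserve between two successive claims, started from the level `y`, for an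
inter-claim time `t` and a claim of size `s`, when the premium rate is frozen at `c + θ / y` and the
inter-claim time is truncated at `δ * y`, so that the reserve does not leave the range of the
levels comparable with `y`. -/
noncomputable def truncJump (c θ δ y t s : ℝ) : ℝ := (c + θ / y) * min t (δ * y) - s

variable {c θ δ y t s κ : ℝ}

theorem abs_truncJump_le (hc : 0 ≤ c) (hθ : 0 ≤ θ) (hδ : 0 ≤ δ) (hy : 1 ≤ y) (ht : 0 ≤ t)
    (hs : 0 ≤ s) : |truncJump c θ δ y t s| ≤ (c + θ) * min t (δ * y) + s := by
  have hy₀ : 0 < y := one_pos.trans_le hy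
  have hmin : 0 ≤ min t (δ * y) := le_min ht (by positivity)
  refine (abs_sub _ _).trans ?_
  rw [abs_of_nonneg hs, abs_of_nonneg (by positivity)]
  gcongr
  exact div_le_self hθ hy

theorem abs_truncJump_le_mul (hc : 0 ≤ c) (hθ : 0 ≤ θ) (hδ : 0 ≤ δ) (hy : 1 ≤ y) (ht : 0 ≤ t)
    (hs : 0 ≤ s) (hsy : s ≤ δ * y) : |truncJump c θ δ y t s| ≤ (c + θ + 1) * δ * y := by
  calc |truncJump c θ δ y t s| ≤ (c + θ) * min t (δ * y) + s :=
        abs_truncJump_le hc hθ hδ hy ht hs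
    _ ≤ (c + θ) * (δ * y) + δ * y := by gcongr; exact min_le_right _ _
    _ = (c + θ + 1) * δ * y := by ring

theorem mul_sub_min_le_sq_div (hδ : 0 < δ) : y * (t - min t (δ * y)) ≤ t ^ 2 / δ := by
  rcases le_total t (δ * y) with hty | hty
  · rw [min_eq_left hty, sub_self, mul_zero]
    positivity
  · rw [min_eq_right hty, le_div_iff₀ hδ]
    nlinarith [sq_nonneg (t - δ * y)]

theorem mul_truncJump (c θ δ t s : ℝ) (hy : y ≠ 0) :
    y * truncJump c θ δ y t s =
      y * (c * t - s) + θ * min t (δ * y) - c * (y * (t - min t (δ * y))) := by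
  unfold truncJump
  field_simp
  ring

theorem abs_ite_truncJump_sub_le (hc : 0 ≤ c) (hθ : 0 ≤ θ) (hδ : 0 < δ) (hκ : 0 ≤ κ) (hy : 1 ≤ y)
    (ht : 0 ≤ t) (hs : 0 ≤ s) :
    |(if s ≤ δ * y then y * truncJump c θ δ y t s - κ * truncJump c θ δ y t s ^ 2 else 0) -
        y * (c * t - s)| ≤
      θ * t + c * (t ^ 2 / δ) + κ * ((c + θ) * t + s) ^ 2 + δ⁻¹ * s * (c * t + s) := by
  have hy₀ : 0 < y := one_pos.trans_le hy
  have hmin : 0 ≤ min t (δ * y) := le_min ht (by positivity)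
  have hsub : 0 ≤ t - min t (δ * y) := sub_nonneg.2 (min_le_left _ _)
  split_ifs with hsy
  · have hsq : truncJump c θ δ y t s ^ 2 ≤ ((c + θ) * t + s) ^ 2 := by
      refine sq_le_sq.2 ((abs_truncJump_le hc hθ hδ.le hy ht hs).trans (le_abs_self _ |>.trans' ?_))
      gcongr
      exact min_le_left _ _
    calc |y * truncJump c θ δ y t s - κ * truncJump c θ δ y t s ^ 2 - y * (c * t - s)|
        = |θ * min t (δ * y) - c * (y * (t - min t (δ * y))) -
            κ * truncJump c θ δ y t s ^ 2| := by
          rw [mul_truncJump c θ δ t s hy₀.ne']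
          ring_nf
      _ ≤ θ * min t (δ * y) + c * (y * (t - min t (δ * y))) + κ * truncJump c θ δ y t s ^ 2 := by
          rw [abs_le]
          constructor <;> nlinarith [mul_nonneg hθ hmin, mul_nonneg hc (mul_nonneg hy₀.le hsub),
            mul_nonneg hκ (sq_nonneg (truncJump c θ δ y t s))]
      _ ≤ θ * t + c * (t ^ 2 / δ) + κ * ((c + θ) * t + s) ^ 2 := by
          gcongr
          · exact min_le_left _ _
          · exact mul_sub_min_le_sq_div hδ
      _ ≤ _ := le_add_of_nonneg_right (by positivity)
  · have hys : y ≤ δ⁻¹ * s := (le_inv_mul_iff₀ hδ).2 (not_le.1 hsy).le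
    calc |0 - y * (c * t - s)| = y * |c * t - s| := by
          rw [zero_sub, abs_neg, abs_mul, abs_of_pos hy₀]
      _ ≤ δ⁻¹ * s * (c * t + s) := by
          gcongr
          exact (abs_sub _ _).trans_eq (by rw [abs_of_nonneg (by positivity), abs_of_nonneg hs])
      _ ≤ _ := le_add_of_nonneg_left (by positivity)

theorem tendsto_ite_truncJump_sub (c θ : ℝ) (hδ : 0 < δ) (κ t s : ℝ) :
    Tendsto (fun y => (if s ≤ δ * y then
        y * truncJump c θ δ y t s - κ * truncJump c θ δ y t s ^ 2 else 0) - y * (c * t - s))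
      atTop (𝓝 (θ * t - κ * (c * t - s) ^ 2)) := by
  have hlim : Tendsto (fun y => θ * t - κ * ((c + θ / y) * t - s) ^ 2) atTop
      (𝓝 (θ * t - κ * ((c + 0) * t - s) ^ 2)) :=
    ((((tendsto_const_nhds.div_atTop tendsto_id).const_add c).mul_const t).sub_const s).pow 2
      |>.const_mul κ |>.const_sub (θ * t)
  rw [add_zero] at hlim
  have hδy : Tendsto (fun y => δ * y) atTop atTop := tendsto_id.const_mul_atTop hδ
  refine hlim.congr' ?_
  filter_upwards [hδy.eventually_ge_atTop s, hδy.eventually_ge_atTop t, eventually_ne_atTop 0]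
    with y hs ht hy
  rw [if_pos hs, truncJump, min_eq_left ht]
  field_simp
  ring

variable {Ω : Type*} [MeasurableSpace Ω] {μ : Measure Ω} [IsFiniteMeasure μ] {T S : Ω → ℝ}

theorem memLp_truncJump (hT : MemLp T 2 μ) (hS : MemLp S 2 μ) (c θ δ y : ℝ) :
    MemLp (fun ω => truncJump c θ δ y (T ω) (S ω)) 2 μ :=
  ((hT.inf (memLp_const (δ * y))).const_mul (c + θ / y)).sub hS

theorem integrable_truncJump_sub_sq (hT : MemLp T 2 μ) (hS : MemLp S 2 μ) (c θ δ κ y : ℝ) :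
    Integrable (fun ω => y * truncJump c θ δ y (T ω) (S ω) -
      κ * truncJump c θ δ y (T ω) (S ω) ^ 2) μ :=
  ((memLp_truncJump hT hS c θ δ y).integrable one_le_two).const_mul y |>.sub
    ((memLp_truncJump hT hS c θ δ y).integrable_sq.const_mul κ)

theorem tendsto_setIntegral_truncJump (hT : MemLp T 2 μ) (hS : MemLp S 2 μ) (hS_meas : Measurable S)
    (hT₀ : 0 ≤ᵐ[μ] T) (hS₀ : 0 ≤ᵐ[μ] S) (hmean : ∫ ω, S ω ∂μ = c * ∫ ω, T ω ∂μ) (hc : 0 ≤ c)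
    (hθ : 0 ≤ θ) (hδ : 0 < δ) (hκ : 0 ≤ κ) :
    Tendsto (fun y => ∫ ω in {ω | S ω ≤ δ * y}, (y * truncJump c θ δ y (T ω) (S ω) -
        κ * truncJump c θ δ y (T ω) (S ω) ^ 2) ∂μ) atTop
      (𝓝 (θ * ∫ ω, T ω ∂μ - κ * ∫ ω, (c * T ω - S ω) ^ 2 ∂μ)) := by
  have hT₁ : Integrable T μ := hT.integrable one_le_two
  have hS₁ : Integrable S μ := hS.integrable one_le_two
  have hcT : MemLp (fun ω => c * T ω - S ω) 2 μ := (hT.const_mul c).sub hS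
  have hcentered (y : ℝ) : ∫ ω, y * (c * T ω - S ω) ∂μ = 0 := by
    rw [integral_const_mul, integral_sub (hT₁.const_mul c) hS₁, integral_const_mul, hmean]
    ring
  have hbound : Integrable (fun ω => θ * T ω + c * (T ω ^ 2 / δ) +
      κ * ((c + θ) * T ω + S ω) ^ 2 + δ⁻¹ * S ω * (c * T ω + S ω)) μ := by
    refine (((hT₁.const_mul θ).add ((hT.integrable_sq.div_const δ).const_mul c)).add
      ((((hT.const_mul (c + θ)).add hS).integrable_sq).const_mul κ)).add ?_
    exact (hS.const_mul δ⁻¹).integrable_mul ((hT.const_mul c).add hS)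
  have hset (y : ℝ) : MeasurableSet {ω | S ω ≤ δ * y} := measurableSet_le hS_meas measurable_const
  have hjump (y : ℝ) := (integrable_truncJump_sub_sq hT hS c θ δ κ y).indicator (hset y)
  have hdrift (y : ℝ) := (hcT.integrable one_le_two).const_mul y
  have hlim := tendsto_integral_filter_of_dominated_convergence (μ := μ) (l := atTop)
    (F := fun y ω => {ω | S ω ≤ δ * y}.indicator (fun ω => y * truncJump c θ δ y (T ω) (S ω) -
        κ * truncJump c θ δ y (T ω) (S ω) ^ 2) ω - y * (c * T ω - S ω)) _
    (.of_forall fun y => ((hjump y).sub (hdrift y)).1) ?_ hbound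
    (.of_forall fun ω => tendsto_ite_truncJump_sub c θ hδ κ (T ω) (S ω))
  · rw [integral_sub (hT₁.const_mul θ) (hcT.integrable_sq.const_mul κ), integral_const_mul,
      integral_const_mul] at hlim
    refine hlim.congr fun y => ?_
    rw [integral_sub (hjump y) (hdrift y), hcentered, sub_zero, integral_indicator (hset y)]
  · filter_upwards [eventually_ge_atTop 1] with y hy
    filter_upwards [hT₀, hS₀] with ω hTω hSω
    exact abs_ite_truncJump_sub_le hc hθ hδ hκ hy hTω hSω

end Drift

section Superharmonic

variable {Ω : Type*} [MeasurableSpace Ω] {μ : Measure Ω} {T S : Ω → ℝ} {c θ b : ℝ}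

theorem integrableOn_sq_map (hS : MemLp S 2 μ) :
    IntegrableOn (fun s => s ^ 2) (Set.Ioi 0) (μ.map S) :=
  ((integrable_map_measure (g := fun s => s ^ 2) (by fun_prop) hS.1.aemeasurable).2
    hS.integrable_sq).integrableOn

theorem lyapunov_max_add_le_indicator {ν : Measure ℝ} {δ η κ x₁ y t s : ℝ} (hb : 0 < b)
    (hν : IntegrableOn (fun s => s ^ 2) (Set.Ioi 0) ν)
    (hstep : ∀ y > 0, ∀ J : ℝ, |J| ≤ η * y →
      lyapunov ν b (y + J) ≤ lyapunov ν b y - lyapunovRate ν b y * (y * J - κ * J ^ 2))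
    (hc : 0 ≤ c) (hθ : 0 ≤ θ) (hδ : 0 ≤ δ) (hδη : (c + θ + 1) * δ ≤ η) (hη : η ≤ 1)
    (hx₁ : 1 ≤ x₁) (hy : x₁ ≤ y) (ht : 0 ≤ t) (hs : 0 ≤ s) :
    lyapunov ν b (max (y + truncJump c θ δ y t s) x₁) ≤ lyapunov ν b y -
        lyapunovRate ν b y * (if s ≤ δ * y then y * truncJump c θ δ y t s -
          κ * truncJump c θ δ y t s ^ 2 else 0) +
        lyapunov ν b x₁ * (if s ≤ δ * y then 0 else 1) := by
  have hy₁ : 1 ≤ y := hx₁.trans hy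
  have hx₁₀ : 0 ≤ x₁ := zero_le_one.trans hx₁
  split_ifs with hsy
  · have hJ : |truncJump c θ δ y t s| ≤ η * y :=
      (abs_truncJump_le_mul hc hθ hδ hy₁ ht hs hsy).trans (by gcongr)
    have hpos : 0 ≤ y + truncJump c θ δ y t s := by nlinarith [neg_abs_le (truncJump c θ δ y t s)]
    rw [mul_zero, add_zero]
    exact (lyapunov_antitoneOn hb.le hν hpos (le_max_of_le_left hpos) (le_max_left _ _)).trans
      (hstep y (by linarith) _ hJ)
  · rw [mul_zero, sub_zero, mul_one]
    exact (lyapunov_antitoneOn hb.le hν hx₁₀ (le_max_of_le_right hx₁₀) (le_max_right _ _)).trans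
      (le_add_of_nonneg_left (lyapunov_nonneg ν b y))

theorem eventually_lyapunov_mul_measureReal_le {ν : Measure ℝ} [IsFiniteMeasure ν] {δ γ a : ℝ}
    (hb : 0 < b) (hν : IntegrableOn (fun s => s ^ 2) (Set.Ioi 0) ν)
    (hgt : DoublingGT (fun x => ν.real (Set.Ioi x)) a) (hδ : 0 < δ) (hγ : 0 < γ) :
    ∀ᶠ x₁ in atTop, ∀ y ≥ x₁,
      lyapunov ν b x₁ * ν.real (Set.Ioi (δ * y)) ≤ lyapunovRate ν b y * γ := by
  obtain ⟨k, hk, hkF⟩ := hgt.exists_mul_le_comp_mul antitone_measureReal_Ioi δ⁻¹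
  set d := b * 2 ^ (-(b / 2) - 1)
  have hd : 0 < d := by positivity
  have hcomp := (tendsto_id.const_mul_atTop hδ).eventually hkF
  filter_upwards [eventually_forall_ge_atTop.2 hcomp, eventually_gt_atTop 0,
    (tendsto_lyapunov_atTop hb hν).eventually_le_const (show 0 < d * γ * k by positivity)]
    with x₁ htail hx₁ hV y hy
  have htail_y : k * ν.real (Set.Ioi (δ * y)) ≤ ν.real (Set.Ioi y) := by
    simpa only [id, inv_mul_cancel_left₀ hδ.ne'] using htail y hy
  calc lyapunov ν b x₁ * ν.real (Set.Ioi (δ * y))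
      ≤ d * γ * k * ν.real (Set.Ioi (δ * y)) := by gcongr
    _ = d * γ * (k * ν.real (Set.Ioi (δ * y))) := by ring
    _ ≤ d * γ * ν.real (Set.Ioi y) := by gcongr
    _ = d * ν.real (Set.Ioi y) * γ := by ring
    _ ≤ lyapunovRate ν b y * γ := by
        gcongr
        exact le_lyapunovRate hb.le hν (hx₁.trans_le hy)

theorem lintegral_ofReal_le_of_ae_le_indicator [IsProbabilityMeasure μ] {f g : Ω → ℝ} {A : Set Ω}
    {p q r : ℝ} (hA : MeasurableSet A) (hg : Integrable g μ) (hf : 0 ≤ f)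
    (hfg : ∀ᵐ ω ∂μ, f ω ≤ p - q * A.indicator g ω + Aᶜ.indicator (fun _ => r) ω) :
    ∫⁻ ω, ENNReal.ofReal (f ω) ∂μ ≤
      ENNReal.ofReal (p - q * ∫ ω in A, g ω ∂μ + r * μ.real Aᶜ) := by
  have hgA : Integrable (fun ω => q * A.indicator g ω) μ := (hg.indicator hA).const_mul q
  have hsub : Integrable (fun ω => p - q * A.indicator g ω) μ := (integrable_const p).sub hgA
  have hr : Integrable (Aᶜ.indicator fun _ => r) μ := (integrable_const r).indicator hA.compl
  calc ∫⁻ ω, ENNReal.ofReal (f ω) ∂μ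
      ≤ ∫⁻ ω, ENNReal.ofReal (p - q * A.indicator g ω + Aᶜ.indicator (fun _ => r) ω) ∂μ :=
        lintegral_mono_ae (hfg.mono fun ω hω => ENNReal.ofReal_le_ofReal hω)
    _ = ENNReal.ofReal (∫ ω, (p - q * A.indicator g ω + Aᶜ.indicator (fun _ => r) ω) ∂μ) :=
        (ofReal_integral_eq_lintegral_ofReal (hsub.add hr)
          (hfg.mono fun ω hω => (hf ω).trans hω)).symm
    _ = ENNReal.ofReal (p - q * ∫ ω in A, g ω ∂μ + r * μ.real Aᶜ) := by
        rw [integral_add hsub hr, integral_sub (integrable_const p) hgA, integral_const_mul,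
          integral_indicator hA, integral_indicator hA.compl, setIntegral_const, integral_const,
          probReal_univ, one_smul, smul_eq_mul, mul_comm r]

variable [IsProbabilityMeasure μ]

theorem lintegral_lyapunov_max_add_le (hT : MemLp T 2 μ) (hS : MemLp S 2 μ)
    (hS_meas : Measurable S) (hT₀ : 0 ≤ᵐ[μ] T) (hS₀ : 0 ≤ᵐ[μ] S) {δ η κ γ x₁ y : ℝ} (hb : 0 < b)
    (hstep : ∀ y > 0, ∀ J : ℝ, |J| ≤ η * y → lyapunov (μ.map S) b (y + J) ≤
      lyapunov (μ.map S) b y - lyapunovRate (μ.map S) b y * (y * J - κ * J ^ 2))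
    (hc : 0 ≤ c) (hθ : 0 ≤ θ) (hδ : 0 ≤ δ) (hδη : (c + θ + 1) * δ ≤ η) (hη : η ≤ 1)
    (hx₁ : 1 ≤ x₁) (hy : x₁ ≤ y)
    (hγ : γ ≤ ∫ ω in {ω | S ω ≤ δ * y}, (y * truncJump c θ δ y (T ω) (S ω) -
        κ * truncJump c θ δ y (T ω) (S ω) ^ 2) ∂μ)
    (hcompensate : lyapunov (μ.map S) b x₁ * (μ.map S).real (Set.Ioi (δ * y)) ≤
      lyapunovRate (μ.map S) b y * γ) :
    ∫⁻ ω, ENNReal.ofReal (lyapunov (μ.map S) b (max (y + truncJump c θ δ y (T ω) (S ω)) x₁)) ∂μ ≤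
      ENNReal.ofReal (lyapunov (μ.map S) b y) := by
  have hset : MeasurableSet {ω | S ω ≤ δ * y} := measurableSet_le hS_meas measurable_const
  have htail : μ.real {ω | S ω ≤ δ * y}ᶜ = (μ.map S).real (Set.Ioi (δ * y)) := by
    rw [map_measureReal_apply hS_meas measurableSet_Ioi]
    congr 1
    ext ω
    simp
  refine (lintegral_ofReal_le_of_ae_le_indicator (p := lyapunov (μ.map S) b y)
    (q := lyapunovRate (μ.map S) b y) (r := lyapunov (μ.map S) b x₁) hset
    (integrable_truncJump_sub_sq hT hS c θ δ κ y) (fun ω => lyapunov_nonneg _ _ _) ?_).trans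
    (ENNReal.ofReal_le_ofReal ?_)
  · filter_upwards [hT₀, hS₀] with ω hTω hSω
    refine (lyapunov_max_add_le_indicator hb (integrableOn_sq_map hS) hstep hc hθ hδ hδη hη hx₁ hy
      hTω hSω).trans_eq ?_
    by_cases hsy : S ω ≤ δ * y <;> simp [Set.indicator, hsy]
  · rw [htail]
    nlinarith [mul_le_mul_of_nonneg_left hγ (lyapunovRate_nonneg hb.le (μ.map S) y)]

theorem exists_lintegral_lyapunov_le (hT : MemLp T 2 μ) (hS : MemLp S 2 μ) (hS_meas : Measurable S)
    (hT₀ : 0 ≤ᵐ[μ] T) (hS₀ : 0 ≤ᵐ[μ] S) (hmean : ∫ ω, S ω ∂μ = c * ∫ ω, T ω ∂μ) (hc : 0 ≤ c)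
    (hθ : 0 ≤ θ) (hb : 0 < b) {κ : ℝ} (hκ : (b + 1) / 2 < κ)
    (hdrift : κ * ∫ ω, (c * T ω - S ω) ^ 2 ∂μ < θ * ∫ ω, T ω ∂μ) {a : ℝ}
    (hgt : DoublingGT (fun x => (μ.map S).real (Set.Ioi x)) a) :
    ∃ δ₀ > 0, ∀ δ ∈ Set.Ioc 0 δ₀, ∀ᶠ x₁ in atTop, ∀ y ≥ x₁,
      ∫⁻ ω, ENNReal.ofReal (lyapunov (μ.map S) b
        (max (y + truncJump c θ δ y (T ω) (S ω)) x₁)) ∂μ ≤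
          ENNReal.ofReal (lyapunov (μ.map S) b y) := by
  have hν : IntegrableOn (fun s => s ^ 2) (Set.Ioi 0) (μ.map S) := integrableOn_sq_map hS
  obtain ⟨η, hη, hstep⟩ := exists_lyapunov_add_le hb hν hκ
  refine ⟨min η 1 / (c + θ + 1), by positivity, fun δ ⟨hδ, hδη⟩ => ?_⟩
  rw [le_div_iff₀' (by positivity)] at hδη
  have hlim := tendsto_setIntegral_truncJump hT hS hS_meas hT₀ hS₀ hmean hc hθ hδ
    (show 0 ≤ κ by linarith)
  obtain ⟨γ, hγ, hγ_lt⟩ := exists_between (sub_pos.2 hdrift)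
  filter_upwards [eventually_forall_ge_atTop.2 (hlim.eventually_const_le hγ_lt),
    eventually_ge_atTop 1, eventually_lyapunov_mul_measureReal_le hb hν hgt hδ hγ]
    with x₁ hγ_le hx₁ hcompensate y hy
  exact lintegral_lyapunov_max_add_le hT hS hS_meas hT₀ hS₀ hb
    (fun y hy J hJ => hstep y hy J (hJ.trans (by gcongr; exact min_le_left _ _))) hc hθ hδ.le hδη
    (min_le_right _ _) hx₁ hy (hγ_le y hy) (hcompensate y hy)

end Superharmonic

section DrivenChain

variable {Ω E S : Type*} [MeasurableSpace E] [mS : MeasurableSpace S] {f : E → S → E}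
  {Z : ℕ → Ω → S} {V : E → ENNReal}

/-- The chain `Y` with `Y 0 = y` and `Y (n + 1) = f (Y n) (Z n)`; it is a Markov chain when the
innovations `Z n` are i.i.d. -/
def drivenChain (f : E → S → E) (Z : ℕ → Ω → S) (y : E) : ℕ → Ω → E
  | 0, _ => y
  | n + 1, ω => f (drivenChain f Z y n ω) (Z n ω)

/-- The σ-algebra generated by `Z i` for `i < n`. -/
abbrev priorSigma (Z : ℕ → Ω → S) (n : ℕ) : MeasurableSpace Ω :=
  ⨆ i ∈ Set.Iio n, MeasurableSpace.comap (Z i) mS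

theorem priorSigma_mono (Z : ℕ → Ω → S) : Monotone (priorSigma Z) :=
  fun _ _ hmn => biSup_mono fun _ hi => lt_of_lt_of_le hi hmn

theorem measurable_priorSigma (Z : ℕ → Ω → S) {i n : ℕ} (hi : i < n) :
    Measurable[priorSigma Z n] (Z i) :=
  measurable_iff_comap_le.2
    (le_biSup (fun i => MeasurableSpace.comap (Z i) mS) (show i ∈ Set.Iio n from hi))

theorem measurable_drivenChain_priorSigma (hf : Measurable (Function.uncurry f)) (y : E) (n : ℕ) :
    Measurable[priorSigma Z n] (drivenChain f Z y n) := by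
  induction n with
  | zero => exact @measurable_const _ _ _ (_) _
  | succ n ih =>
    exact hf.comp ((ih.mono (priorSigma_mono Z n.le_succ) le_rfl).prodMk
      (measurable_priorSigma Z n.lt_succ_self))

variable [MeasurableSpace Ω] {μ : Measure Ω}

theorem measurable_drivenChain (hf : Measurable (Function.uncurry f)) (hZ : ∀ n, Measurable (Z n))
    (y : E) (n : ℕ) : Measurable (drivenChain f Z y n) :=
  (measurable_drivenChain_priorSigma hf y n).mono
    (iSup₂_le fun i _ => measurable_iff_comap_le.1 (hZ i)) le_rfl

theorem indepFun_drivenChain (hf : Measurable (Function.uncurry f))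
    (hZ : ∀ n, Indep (priorSigma Z n) (MeasurableSpace.comap (Z n) mS) μ) (y : E) (n : ℕ) :
    IndepFun (drivenChain f Z y n) (Z n) μ :=
  indep_of_indep_of_le_left (hZ n)
    (measurable_iff_comap_le.1 (measurable_drivenChain_priorSigma hf y n))

theorem lintegral_comp_eq_lintegral_lintegral [IsFiniteMeasure μ] {X : Ω → E} {W W' : Ω → S}
    (hX : Measurable X) (hXW : IndepFun X W μ) (hWW' : IdentDistrib W W' μ μ)
    {G : E × S → ENNReal} (hG : Measurable G) :
    ∫⁻ ω, G (X ω, W ω) ∂μ = ∫⁻ ω, ∫⁻ ω', G (X ω, W' ω') ∂μ ∂μ := by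
  have hW := hWW'.aemeasurable_fst
  calc ∫⁻ ω, G (X ω, W ω) ∂μ
      = ∫⁻ z, G z ∂((μ.map X).prod (μ.map W')) := by
        rw [← hWW'.map_eq, ← (indepFun_iff_map_prod_eq_prod_map_map hX.aemeasurable hW).1 hXW,
          lintegral_map' hG.aemeasurable (hX.aemeasurable.prodMk hW)]
    _ = ∫⁻ ω, ∫⁻ s, G (X ω, s) ∂(μ.map W') ∂μ := by
        rw [lintegral_prod _ hG.aemeasurable, lintegral_map hG.lintegral_prod_right' hX]
    _ = ∫⁻ ω, ∫⁻ ω', G (X ω, W' ω') ∂μ ∂μ :=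
        lintegral_congr fun ω =>
          lintegral_map' (by fun_prop) hWW'.aemeasurable_snd

variable [IsProbabilityMeasure μ]

theorem lintegral_drivenChain_le (hf : Measurable (Function.uncurry f))
    (hZ_meas : ∀ n, Measurable (Z n))
    (hZ : ∀ n, Indep (priorSigma Z n) (MeasurableSpace.comap (Z n) mS) μ)
    (hZ_ident : ∀ n, IdentDistrib (Z n) (Z 0) μ μ) (hV : Measurable V) {K : ENNReal}
    (hstep : ∀ y, ∫⁻ ω, V (f y (Z 0 ω)) ∂μ ≤ V y + K) (y : E) (n : ℕ) :
    ∫⁻ ω, V (drivenChain f Z y n ω) ∂μ ≤ V y + n * K := by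
  induction n with
  | zero => simp [drivenChain]
  | succ n ih =>
    calc ∫⁻ ω, V (drivenChain f Z y (n + 1) ω) ∂μ
        = ∫⁻ ω, ∫⁻ ω', V (f (drivenChain f Z y n ω) (Z 0 ω')) ∂μ ∂μ :=
          lintegral_comp_eq_lintegral_lintegral (measurable_drivenChain hf hZ_meas y n)
            (indepFun_drivenChain hf hZ y n) (hZ_ident n) (hV.comp hf)
      _ ≤ ∫⁻ ω, (V (drivenChain f Z y n ω) + K) ∂μ := lintegral_mono fun ω => hstep _
      _ = ∫⁻ ω, V (drivenChain f Z y n ω) ∂μ + K := by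
          rw [lintegral_add_right _ measurable_const, lintegral_const, measure_univ, mul_one]
      _ ≤ V y + n * K + K := by gcongr
      _ = V y + (n + 1 : ℕ) * K := by
          push_cast
          ring

theorem mul_measure_exists_drivenChain_mem_le (hf : Measurable (Function.uncurry f))
    (hZ_meas : ∀ n, Measurable (Z n))
    (hZ : ∀ n, Indep (priorSigma Z n) (MeasurableSpace.comap (Z n) mS) μ)
    (hZ_ident : ∀ n, IdentDistrib (Z n) (Z 0) μ μ) (hV : Measurable V)
    (hstep : ∀ y, ∫⁻ ω, V (f y (Z 0 ω)) ∂μ ≤ V y) {A : Set E} {v : ENNReal}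
    (hA : ∀ y ∈ A, ∀ s, f y s ∈ A) (hVA : ∀ y ∈ A, v ≤ V y) (y : E) :
    v * μ {ω | ∃ n, drivenChain f Z y n ω ∈ A} ≤ V y := by
  have hmono : Monotone fun n => {ω | drivenChain f Z y n ω ∈ A} :=
    monotone_nat_of_le_succ fun n ω hω => hA _ hω _
  rw [Set.ofPred_exists, hmono.measure_iUnion, ENNReal.mul_iSup]
  refine iSup_le fun n => ?_
  calc v * μ {ω | drivenChain f Z y n ω ∈ A}
      ≤ v * μ {ω | v ≤ V (drivenChain f Z y n ω)} := by
        gcongr with ω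
        exact hVA _
    _ ≤ ∫⁻ ω, V (drivenChain f Z y n ω) ∂μ :=
        mul_meas_ge_le_lintegral (hV.comp (measurable_drivenChain hf hZ_meas y n)) v
    _ ≤ V y := by
        simpa using lintegral_drivenChain_le hf hZ_meas hZ hZ_ident hV
          (K := 0) (by simpa using hstep) y n

end DrivenChain

section ClaimInputs

variable {Ω : Type*} [MeasurableSpace Ω] {μ : Measure Ω} {τ ξ : ℕ → Ω → ℝ}

/-- The probabilistic inputs of the model: two independent i.i.d. sequences of square integrable
nonnegative random variables, of inter-claim times `τ` with positive mean and of claim sizes `ξ`. -/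
structure ClaimInputs (μ : Measure Ω) (τ ξ : ℕ → Ω → ℝ) : Prop where
  meas_time : ∀ n, Measurable (τ n)
  meas_size : ∀ n, Measurable (ξ n)
  nonneg_time : ∀ n, 0 ≤ᵐ[μ] τ n
  nonneg_size : ∀ n, 0 ≤ᵐ[μ] ξ n
  indep : iIndepFun (Sum.elim τ ξ) μ
  ident_time : ∀ n, IdentDistrib (τ n) (τ 0) μ μ
  ident_size : ∀ n, IdentDistrib (ξ n) (ξ 0) μ μ
  mean_pos : 0 < ∫ ω, τ 0 ω ∂μ
  memLp_time : MemLp (τ 0) 2 μ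
  memLp_size : MemLp (ξ 0) 2 μ

namespace ClaimInputs

theorem indepFun_time_size (h : ClaimInputs μ τ ξ) (m n : ℕ) : IndepFun (τ m) (ξ n) μ :=
  h.indep.indepFun (show Sum.inl m ≠ Sum.inr n from Sum.inl_ne_inr)

theorem measurable_pair (h : ClaimInputs μ τ ξ) (n : ℕ) : Measurable fun ω => (τ n ω, ξ n ω) :=
  (h.meas_time n).prodMk (h.meas_size n)

theorem ae_nonneg (h : ClaimInputs μ τ ξ) : ∀ᵐ ω ∂μ, ∀ n, 0 ≤ τ n ω ∧ 0 ≤ ξ n ω :=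
  ae_all_iff.2 fun n => (h.nonneg_time n).and (h.nonneg_size n)

theorem indep_priorSigma (h : ClaimInputs μ τ ξ) (n : ℕ) :
    Indep (priorSigma (fun n ω => (τ n ω, ξ n ω)) n)
      (MeasurableSpace.comap (fun ω => (τ n ω, ξ n ω)) inferInstance) μ := by
  let σ (i : ℕ ⊕ ℕ) : MeasurableSpace Ω := MeasurableSpace.comap (Sum.elim τ ξ i) inferInstance
  have hpair {J : Set (ℕ ⊕ ℕ)} {i : ℕ} (hτ : Sum.inl i ∈ J) (hξ : Sum.inr i ∈ J) :
      MeasurableSpace.comap (fun ω => (τ i ω, ξ i ω)) inferInstance ≤ ⨆ j ∈ J, σ j := by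
    exact (MeasurableSpace.comap_prodMk (τ i) (ξ i)).trans_le
      (sup_le (le_biSup σ hτ) (le_biSup σ hξ))
  have hmeas (i : ℕ ⊕ ℕ) : Measurable (Sum.elim τ ξ i) := by
    cases i with
    | inl i => exact h.meas_time i
    | inr i => exact h.meas_size i
  have hindep : Indep (⨆ j ∈ {j | Sum.elim id id j < n}, σ j)
      (⨆ j ∈ {j | Sum.elim id id j = n}, σ j) μ :=
    indep_iSup_of_disjoint (fun i => measurable_iff_comap_le.1 (hmeas i)) h.indep
      (Set.disjoint_left.2 fun _ hlt heq => hlt.ne heq)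
  exact indep_of_indep_of_le_left (indep_of_indep_of_le_right hindep (hpair rfl rfl))
    (iSup₂_le fun i hi => hpair hi hi)

variable [IsProbabilityMeasure μ]

theorem identDistrib_pair (h : ClaimInputs μ τ ξ) (n : ℕ) :
    IdentDistrib (fun ω => (τ n ω, ξ n ω)) (fun ω => (τ 0 ω, ξ 0 ω)) μ μ :=
  (h.ident_time n).prodMk (h.ident_size n) (h.indepFun_time_size n n) (h.indepFun_time_size 0 0)

theorem ae_tendsto_claimEpoch (h : ClaimInputs μ τ ξ) :
    ∀ᵐ ω ∂μ, Tendsto (fun n => claimEpoch τ n ω) atTop atTop := by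
  have hpairwise : Pairwise (Function.onFun (fun X Y => IndepFun X Y μ) τ) := fun i j hij =>
    h.indep.indepFun (Sum.inl_injective.ne hij)
  filter_upwards [strong_law_ae_real τ (h.memLp_time.integrable one_le_two) hpairwise h.ident_time]
    with ω hω
  refine (hω.pos_mul_atTop h.mean_pos tendsto_natCast_atTop_atTop).congr' ?_
  filter_upwards [eventually_ne_atTop 0] with n hn
  exact div_mul_cancel₀ _ (Nat.cast_ne_zero.2 hn)

end ClaimInputs

end ClaimInputs

section BetweenClaims

variable {v R : ℝ → ℝ} {a b c y z σ : ℝ}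

theorem le_add_integral_of_le_rate (hv : ∀ y, 0 ≤ v y) (hab : a ≤ b)
    (hint : IntervalIntegrable (fun s => v (R s)) volume a b)
    (hR : ∀ t ∈ Set.Ico a b, R t = z + ∫ s in a..t, v (R s)) (hc : 0 ≤ c) (hσ : σ ≤ b - a)
    (hy : y ≤ z) (hvc : ∀ r ∈ Set.Icc y (y + c * σ), c ≤ v r) :
    y + c * σ ≤ z + ∫ s in a..b, v (R s) := by
  by_contra! hlt
  have hrate : ∀ t ∈ Set.Ioo a b, c ≤ v (R t) := by
    intro t ht
    have hpast := intervalIntegral.integral_nonneg (μ := volume) ht.1.le fun s _ => hv (R s)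
    have hmono := intervalIntegral.integral_mono_interval le_rfl ht.1.le ht.2.le
      (.of_forall fun s => hv (R s)) hint
    rw [hR t ⟨ht.1.le, ht.2⟩]
    exact hvc _ ⟨by linarith, by linarith⟩
  have hgrowth :=
    intervalIntegral.integral_mono_on_of_le_Ioo hab intervalIntegrable_const hint hrate
  rw [intervalIntegral.integral_const, smul_eq_mul] at hgrowth
  nlinarith

theorem exists_level_crossing (hab : a ≤ b)
    (hint : IntervalIntegrable (fun s => v (R s)) volume a b)
    (hy : y ≤ z + ∫ s in a..b, v (R s)) :
    ∃ t ∈ Set.Icc a b, y ≤ z + ∫ s in a..t, v (R s) ∧ z + ∫ s in a..t, v (R s) ≤ max z y := by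
  rcases le_total y z with hyz | hzy
  · exact ⟨a, ⟨le_rfl, hab⟩, by simpa using hyz, by simp⟩
  · have hcont : ContinuousOn (fun t => z + ∫ s in a..t, v (R s)) (Set.Icc a b) := by
      have hprim := intervalIntegral.continuousOn_primitive_interval' hint Set.left_mem_uIcc
      rw [Set.uIcc_of_le hab] at hprim
      exact continuousOn_const.add hprim
    obtain ⟨t, ht, hcross⟩ := intermediate_value_Icc hab hcont
      (show y ∈ Set.Icc _ _ from ⟨by simpa using hzy, hy⟩)
    exact ⟨t, ht, hcross.ge, hcross.le.trans (le_max_right _ _)⟩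

theorem add_integral_le_of_rate_le (hv : ∀ y, 0 ≤ v y) (hab : a ≤ b)
    (hint : IntervalIntegrable (fun s => v (R s)) volume a b)
    (hR : ∀ t ∈ Set.Ico a b, R t = z + ∫ s in a..t, v (R s)) (hc : 0 ≤ c)
    (hvc : ∀ r, y ≤ r → v r ≤ c) :
    z + ∫ s in a..b, v (R s) ≤ max z y + c * (b - a) := by
  have hcba : 0 ≤ c * (b - a) := mul_nonneg hc (sub_nonneg.2 hab)
  rcases le_total (z + ∫ s in a..b, v (R s)) y with hle | hge
  · exact (hle.trans (le_max_right _ _)).trans (le_add_of_nonneg_right hcba)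
  obtain ⟨t₀, ht₀, hlevel, hmax⟩ := exists_level_crossing hab hint hge
  have hint₀ (t : ℝ) (ht : t ∈ Set.Icc a b) :
      IntervalIntegrable (fun s => v (R s)) volume a t :=
    hint.mono_set (Set.uIcc_subset_uIcc_left (Set.uIcc_of_le hab ▸ ht))
  have hint₁ : IntervalIntegrable (fun s => v (R s)) volume t₀ b := (hint₀ t₀ ht₀).symm.trans hint
  have hrate : ∀ t ∈ Set.Ioo t₀ b, v (R t) ≤ c := by
    intro t ht
    have hat : a ≤ t := ht₀.1.trans ht.1.le
    have hmono := intervalIntegral.integral_mono_interval (μ := volume) le_rfl ht₀.1 ht.1.le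
      (.of_forall fun s => hv (R s)) (hint₀ t ⟨hat, ht.2.le⟩)
    rw [hR t ⟨hat, ht.2⟩]
    exact hvc _ (by linarith)
  have hgrowth :=
    intervalIntegral.integral_mono_on_of_le_Ioo ht₀.2 hint₁ intervalIntegrable_const hrate
  rw [intervalIntegral.integral_const, smul_eq_mul] at hgrowth
  rw [← intervalIntegral.integral_add_adjacent_intervals (hint₀ t₀ ht₀) hint₁]
  nlinarith [ht₀.1]

end BetweenClaims

section Path

variable {Ω : Type*} {τ ξ : ℕ → Ω → ℝ} {ω : Ω}

theorem claimEpoch_succ (τ : ℕ → Ω → ℝ) (n : ℕ) (ω : Ω) :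
    claimEpoch τ (n + 1) ω = claimEpoch τ n ω + τ n ω := Finset.sum_range_succ _ _

theorem claimEpoch_monotone (hτ : ∀ n, 0 ≤ τ n ω) : Monotone fun n => claimEpoch τ n ω :=
  monotone_nat_of_le_succ fun n => (le_add_of_nonneg_right (hτ n)).trans_eq
    (claimEpoch_succ τ n ω).symm

theorem claimEpoch_nonneg (hτ : ∀ n, 0 ≤ τ n ω) (n : ℕ) : 0 ≤ claimEpoch τ n ω :=
  Finset.sum_nonneg fun i _ => hτ i

theorem claimCount_eq (hτ : ∀ n, 0 ≤ τ n ω) {n : ℕ} {t : ℝ}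
    (ht : t ∈ Set.Ico (claimEpoch τ n ω) (claimEpoch τ (n + 1) ω)) : claimCount τ t ω = n := by
  have hmax : IsGreatest {n : ℕ | claimEpoch τ n ω ≤ t} n :=
    ⟨ht.1, fun m hm => not_lt.1 fun hnm =>
      (ht.2.trans_le (claimEpoch_monotone hτ hnm)).not_ge hm⟩
  exact hmax.csSup_eq

theorem exists_mem_Ico_claimEpoch (hT : Tendsto (fun n => claimEpoch τ n ω) atTop atTop) {t : ℝ}
    (ht : 0 ≤ t) : ∃ n, t ∈ Set.Ico (claimEpoch τ n ω) (claimEpoch τ (n + 1) ω) := by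
  classical
  have hex : ∃ n, t < claimEpoch τ n ω := (hT.eventually_gt_atTop t).exists
  obtain ⟨n, hn⟩ : ∃ n, Nat.find hex = n + 1 := by
    refine Nat.exists_eq_succ_of_ne_zero fun hzero => ht.not_gt ?_
    have hspec := Nat.find_spec hex
    rw [hzero] at hspec
    simpa [claimEpoch] using hspec
  exact ⟨n, not_lt.1 (Nat.find_min hex (hn ▸ n.lt_succ_self)), hn ▸ Nat.find_spec hex⟩

/-- The reserve just after the `n`-th claim. -/
noncomputable def postClaim (v : ℝ → ℝ) (τ ξ : ℕ → Ω → ℝ) (x : ℝ) (R : ℝ → Ω → ℝ) (n : ℕ)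
    (ω : Ω) : ℝ :=
  x + (∫ s in (0 : ℝ)..claimEpoch τ n ω, v (R s ω)) - ∑ j ∈ Finset.range n, ξ j ω

/-- The reserve equation along the trajectory `ω`, together with the regularity that the inputs
have almost surely: nonnegative inter-claim times and claims, and finitely many claims in finite
time. -/
structure ReservePath (v : ℝ → ℝ) (τ ξ : ℕ → Ω → ℝ) (x : ℝ) (R : ℝ → Ω → ℝ) (ω : Ω) : Prop where
  time_nonneg : ∀ n, 0 ≤ τ n ω
  size_nonneg : ∀ n, 0 ≤ ξ n ω
  tendsto_epoch : Tendsto (fun n => claimEpoch τ n ω) atTop atTop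
  reserve_eq : ∀ t : ℝ, 0 ≤ t → IntervalIntegrable (fun s => v (R s ω)) volume 0 t ∧
    R t ω = x + (∫ s in (0 : ℝ)..t, v (R s ω)) - ∑ j ∈ Finset.range (claimCount τ t ω), ξ j ω

theorem postClaim_zero (v : ℝ → ℝ) (τ ξ : ℕ → Ω → ℝ) (x : ℝ) (R : ℝ → Ω → ℝ) (ω : Ω) :
    postClaim v τ ξ x R 0 ω = x := by
  simp [postClaim, claimEpoch]

namespace ReservePath

variable {v : ℝ → ℝ} {x c y σ : ℝ} {R : ℝ → Ω → ℝ}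

theorem intervalIntegrable (h : ReservePath v τ ξ x R ω) {a b : ℝ} (ha : 0 ≤ a) (hb : 0 ≤ b) :
    IntervalIntegrable (fun s => v (R s ω)) volume a b :=
  (h.reserve_eq a ha).1.symm.trans (h.reserve_eq b hb).1

theorem eq_postClaim_add (h : ReservePath v τ ξ x R ω) (n : ℕ) {t : ℝ}
    (ht : t ∈ Set.Ico (claimEpoch τ n ω) (claimEpoch τ (n + 1) ω)) :
    R t ω = postClaim v τ ξ x R n ω + ∫ s in claimEpoch τ n ω..t, v (R s ω) := by
  have hT := claimEpoch_nonneg h.time_nonneg n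
  have ht₀ := hT.trans ht.1
  rw [(h.reserve_eq t ht₀).2, claimCount_eq h.time_nonneg ht, postClaim,
    ← intervalIntegral.integral_add_adjacent_intervals (h.intervalIntegrable le_rfl hT)
      (h.intervalIntegrable hT ht₀)]
  ring

theorem postClaim_succ (h : ReservePath v τ ξ x R ω) (n : ℕ) :
    postClaim v τ ξ x R (n + 1) ω = postClaim v τ ξ x R n ω +
      (∫ s in claimEpoch τ n ω..claimEpoch τ (n + 1) ω, v (R s ω)) - ξ n ω := by
  have hT := claimEpoch_nonneg h.time_nonneg
  rw [postClaim, postClaim,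
    ← intervalIntegral.integral_add_adjacent_intervals (h.intervalIntegrable le_rfl (hT n))
      (h.intervalIntegrable (hT n) (hT (n + 1))), Finset.sum_range_succ]
  ring

theorem le_postClaim_succ (h : ReservePath v τ ξ x R ω) (hv : ∀ y, 0 ≤ v y) {n : ℕ} (hc : 0 ≤ c)
    (hσ : σ ≤ τ n ω) (hy : y ≤ postClaim v τ ξ x R n ω)
    (hvc : ∀ r ∈ Set.Icc y (y + c * σ), c ≤ v r) :
    y + c * σ - ξ n ω ≤ postClaim v τ ξ x R (n + 1) ω := by
  have hT := claimEpoch_nonneg h.time_nonneg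
  have hle : claimEpoch τ n ω ≤ claimEpoch τ (n + 1) ω :=
    claimEpoch_monotone h.time_nonneg n.le_succ
  have hlength : claimEpoch τ (n + 1) ω - claimEpoch τ n ω = τ n ω := by
    rw [claimEpoch_succ, add_sub_cancel_left]
  have hgrowth := le_add_integral_of_le_rate (R := fun s => R s ω) hv hle
    (h.intervalIntegrable (hT n) (hT (n + 1))) (fun t ht => h.eq_postClaim_add n ht) hc
    (hσ.trans_eq hlength.symm) hy hvc
  rw [h.postClaim_succ]
  linarith

theorem postClaim_succ_le (h : ReservePath v τ ξ x R ω) (hv : ∀ y, 0 ≤ v y) (n : ℕ) (hc : 0 ≤ c)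
    (hvc : ∀ r, y ≤ r → v r ≤ c) :
    postClaim v τ ξ x R (n + 1) ω ≤ max (postClaim v τ ξ x R n ω) y + c * τ n ω - ξ n ω := by
  have hT := claimEpoch_nonneg h.time_nonneg
  have hle : claimEpoch τ n ω ≤ claimEpoch τ (n + 1) ω :=
    claimEpoch_monotone h.time_nonneg n.le_succ
  have hlength : claimEpoch τ (n + 1) ω - claimEpoch τ n ω = τ n ω := by
    rw [claimEpoch_succ, add_sub_cancel_left]
  have hgrowth := add_integral_le_of_rate_le (R := fun s => R s ω) hv hle
    (h.intervalIntegrable (hT n) (hT (n + 1))) (fun t ht => h.eq_postClaim_add n ht) hc hvc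
  rw [h.postClaim_succ, ← hlength]
  linarith

theorem nonneg (h : ReservePath v τ ξ x R ω) (hv : ∀ y, 0 ≤ v y)
    (hpost : ∀ n, 0 ≤ postClaim v τ ξ x R n ω) {t : ℝ} (ht : 0 ≤ t) : 0 ≤ R t ω := by
  obtain ⟨n, hn⟩ := exists_mem_Ico_claimEpoch h.tendsto_epoch ht
  rw [h.eq_postClaim_add n hn]
  exact add_nonneg (hpost n) (intervalIntegral.integral_nonneg hn.1 fun s _ => hv _)

-- The inequality is strict when further claims follow the `n`-th one at the same epoch.
theorem reserve_claimEpoch_le (h : ReservePath v τ ξ x R ω) (n : ℕ) :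
    R (claimEpoch τ n ω) ω ≤ postClaim v τ ξ x R n ω := by
  have hT := claimEpoch_nonneg h.time_nonneg n
  obtain ⟨m, hm⟩ := exists_mem_Ico_claimEpoch h.tendsto_epoch hT
  have hnm : n ≤ m := not_lt.1 fun hlt => hm.2.not_ge (claimEpoch_monotone h.time_nonneg hlt)
  rw [(h.reserve_eq _ hT).2, claimCount_eq h.time_nonneg hm, postClaim]
  gcongr
  exact fun j _ _ => h.size_nonneg j

theorem exists_neg (h : ReservePath v τ ξ x R ω) {n : ℕ} (hpost : postClaim v τ ξ x R n ω < 0) :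
    ∃ t, 0 ≤ t ∧ R t ω < 0 :=
  ⟨claimEpoch τ n ω, claimEpoch_nonneg h.time_nonneg n, (h.reserve_claimEpoch_le n).trans_lt hpost⟩

end ReservePath

end Path

section IsRiskReserve

variable {Ω : Type*} [MeasurableSpace Ω] {μ : Measure Ω} [IsProbabilityMeasure μ]
  {τ ξ : ℕ → Ω → ℝ} {v : ℝ → ℝ} {x : ℝ} {R : ℝ → Ω → ℝ}

theorem ClaimInputs.ae_reservePath (h : ClaimInputs μ τ ξ) (hR : IsRiskReserve μ v τ ξ x R) :
    ∀ᵐ ω ∂μ, ReservePath v τ ξ x R ω := by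
  filter_upwards [h.ae_nonneg, h.ae_tendsto_claimEpoch, hR] with ω hnonneg hT hpath
  exact ⟨fun n => (hnonneg n).1, fun n => (hnonneg n).2, hT, hpath⟩

end IsRiskReserve

section Rate

variable {v : ℝ → ℝ} {c θ θ' : ℝ}

theorem eventually_le_rate (hrate : Tendsto (fun z => z * (v z - c)) atTop (𝓝 θ)) (hθ : θ' < θ) :
    ∀ᶠ z in atTop, c + θ' / z ≤ v z := by
  filter_upwards [hrate.eventually_const_lt hθ, eventually_gt_atTop 0] with z hz hz₀
  rw [← le_sub_iff_add_le', div_le_iff₀' hz₀]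
  exact hz.le

theorem eventually_rate_le (hrate : Tendsto (fun z => z * (v z - c)) atTop (𝓝 θ)) (hθ : θ < θ') :
    ∀ᶠ z in atTop, v z ≤ c + θ' / z := by
  filter_upwards [hrate.eventually_lt_const hθ, eventually_gt_atTop 0] with z hz hz₀
  rw [← sub_le_iff_le_add', le_div_iff₀' hz₀]
  exact hz.le

theorem eventually_forall_rate_le (hrate : Tendsto (fun z => z * (v z - c)) atTop (𝓝 θ))
    (hθ : θ < θ') (hθ' : 0 ≤ θ') : ∀ᶠ x in atTop, ∀ r ≥ x, v r ≤ c + θ' / x := by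
  filter_upwards [eventually_forall_ge_atTop.2 (eventually_rate_le hrate hθ),
    eventually_gt_atTop 0] with x hx hx₀ r hr
  exact (hx r hr).trans (by gcongr)

-- Lowering the constant `θ` leaves room for the level to grow by a small proportion.
theorem exists_le_rate_on_Icc (hrate : Tendsto (fun z => z * (v z - c)) atTop (𝓝 θ))
    (hc : 0 ≤ c) (hθ' : 0 < θ') (hθ : θ' < θ) :
    ∃ δ₀ > 0, ∀ δ ≤ δ₀, ∀ᶠ x₁ in atTop, ∀ y ≥ x₁,
      ∀ r ∈ Set.Icc y (y + (c + θ') * (δ * y)), c + θ' / y ≤ v r := by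
  obtain ⟨θ'', hθ'', hθ''θ⟩ := exists_between hθ
  refine ⟨(θ'' - θ') / (θ' * (c + θ')), div_pos (sub_pos.2 hθ'') (by positivity), fun δ hδ => ?_⟩
  rw [le_div_iff₀ (by positivity)] at hδ
  filter_upwards [eventually_forall_ge_atTop.2 (eventually_le_rate hrate hθ''θ),
    eventually_gt_atTop 0] with x₁ hx₁ hx₁₀ y hy r hr
  have hy₀ : 0 < y := hx₁₀.trans_le hy
  have hr₀ : 0 < r := hy₀.trans_le hr.1
  have hslope : θ' / y ≤ θ'' / r := by
    rw [div_le_div_iff₀ hy₀ hr₀]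
    calc θ' * r ≤ θ' * (y + (c + θ') * (δ * y)) := by
          gcongr
          exact hr.2
      _ = (θ' + δ * (θ' * (c + θ'))) * y := by ring
      _ ≤ θ'' * y := by
          gcongr
          linarith
  linarith [hx₁ r (hy.trans hr.1)]

end Rate

section ComparisonChain

variable {Ω : Type*} {τ ξ : ℕ → Ω → ℝ} {c θ δ x₁ x : ℝ}

/-- The step of the comparison chain, which makes the truncated jumps `truncJump` above the level
`x₁` and is stopped on reaching it. -/
noncomputable def comparisonStep (c θ δ x₁ y : ℝ) (p : ℝ × ℝ) : ℝ :=
  if x₁ < y then y + truncJump c θ δ y p.1 p.2 else y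

theorem measurable_comparisonStep (c θ δ x₁ : ℝ) :
    Measurable (Function.uncurry (comparisonStep c θ δ x₁)) := by
  unfold Function.uncurry comparisonStep truncJump
  exact Measurable.ite (measurableSet_lt measurable_const measurable_fst) (by fun_prop)
    measurable_fst

theorem ReservePath.drivenChain_comparisonStep_le {v : ℝ → ℝ} {R : ℝ → Ω → ℝ} {ω : Ω}
    (h : ReservePath v τ ξ x R ω) (hv : ∀ y, 0 ≤ v y) (hc : 0 ≤ c) (hθ : 0 ≤ θ) (hδ : 0 ≤ δ)
    (hx₁ : 1 ≤ x₁)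
    (hrate : ∀ y ≥ x₁, ∀ r ∈ Set.Icc y (y + (c + θ) * (δ * y)), c + θ / y ≤ v r)
    (habove : ∀ n, x₁ < drivenChain (comparisonStep c θ δ x₁) (fun n ω => (τ n ω, ξ n ω)) x n ω)
    (n : ℕ) : drivenChain (comparisonStep c θ δ x₁) (fun n ω => (τ n ω, ξ n ω)) x n ω ≤
      postClaim v τ ξ x R n ω := by
  induction n with
  | zero => exact (postClaim_zero v τ ξ x R ω).ge
  | succ n ih =>
    have hy := habove n
    rw [drivenChain, comparisonStep, if_pos hy, truncJump, ← add_sub_assoc]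
    set y := drivenChain (comparisonStep c θ δ x₁) (fun n ω => (τ n ω, ξ n ω)) x n ω
    have hy₁ : 1 ≤ y := hx₁.trans hy.le
    have hslope : θ / y ≤ θ := div_le_self hθ hy₁
    have hmin : 0 ≤ min (τ n ω) (δ * y) := le_min (h.time_nonneg n) (by positivity)
    have hgain : (c + θ / y) * min (τ n ω) (δ * y) ≤ (c + θ) * (δ * y) := by
      gcongr
      exact min_le_right _ _
    exact h.le_postClaim_succ hv (by positivity) (min_le_left _ _) ih
      fun r hr => hrate y hy.le r ⟨hr.1, hr.2.trans (by gcongr)⟩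

end ComparisonChain

section UpperBound

variable {Ω : Type*} [MeasurableSpace Ω] {μ : Measure Ω} {τ ξ : ℕ → Ω → ℝ}

theorem limitVariance_nonneg (μ : Measure Ω) (T S : Ω → ℝ) : 0 ≤ limitVariance μ T S :=
  add_nonneg (variance_nonneg _ _) (mul_nonneg (sq_nonneg _) (variance_nonneg _ _))

namespace ClaimInputs

variable {v : ℝ → ℝ} {c θ δ x₁ x b : ℝ}

theorem criticalRate_nonneg (h : ClaimInputs μ τ ξ) : 0 ≤ criticalRate μ (τ 0) (ξ 0) :=
  div_nonneg (integral_nonneg_of_ae (h.nonneg_size 0)) h.mean_pos.le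

theorem integral_size_eq (h : ClaimInputs μ τ ξ) :
    ∫ ω, ξ 0 ω ∂μ = criticalRate μ (τ 0) (ξ 0) * ∫ ω, τ 0 ω ∂μ :=
  (div_mul_cancel₀ _ h.mean_pos.ne').symm

theorem exists_slope_lt (h : ClaimInputs μ τ ξ) (hb : 0 < b)
    (hbρ : b < ruinExponent μ (τ 0) (ξ 0) θ) :
    ∃ κ > (b + 1) / 2, ∃ θ' ∈ Set.Ioo 0 θ,
      κ * limitVariance μ (τ 0) (ξ 0) < θ' * ∫ ω, τ 0 ω ∂μ := by
  have hmean := h.mean_pos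
  have hvariance : 0 < limitVariance μ (τ 0) (ξ 0) := by
    refine (limitVariance_nonneg _ _ _).lt_of_ne fun hzero => ?_
    rw [ruinExponent, ← hzero, div_zero] at hbρ
    linarith
  rw [ruinExponent, lt_sub_iff_add_lt, lt_div_iff₀ hvariance] at hbρ
  obtain ⟨θ', hlt, hθ'⟩ := exists_between
    (show (b + 1) / 2 * limitVariance μ (τ 0) (ξ 0) / ∫ ω, τ 0 ω ∂μ < θ by
      rw [div_lt_iff₀ hmean]
      linarith)
  have hθ'₀ : 0 < θ' := lt_of_le_of_lt (by positivity) hlt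
  rw [div_lt_iff₀ hmean, ← lt_div_iff₀ hvariance] at hlt
  obtain ⟨κ, hκ, hκ'⟩ := exists_between hlt
  exact ⟨κ, hκ, θ', ⟨hθ'₀, hθ'⟩, (lt_div_iff₀ hvariance).1 hκ'⟩

variable [IsProbabilityMeasure μ]

theorem integral_step_eq_zero (h : ClaimInputs μ τ ξ) :
    ∫ ω, (criticalRate μ (τ 0) (ξ 0) * τ 0 ω - ξ 0 ω) ∂μ = 0 := by
  rw [integral_sub ((h.memLp_time.integrable one_le_two).const_mul _)
    (h.memLp_size.integrable one_le_two), integral_const_mul, ← h.integral_size_eq, sub_self]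

theorem integral_step_sq_eq (h : ClaimInputs μ τ ξ) :
    ∫ ω, (criticalRate μ (τ 0) (ξ 0) * τ 0 ω - ξ 0 ω) ^ 2 ∂μ =
      limitVariance μ (τ 0) (ξ 0) := by
  have hindep : IndepFun (fun ω => criticalRate μ (τ 0) (ξ 0) * τ 0 ω) (ξ 0) μ :=
    (h.indepFun_time_size 0 0).comp (measurable_const_mul _) measurable_id
  have hmemLp := h.memLp_time.const_mul (criticalRate μ (τ 0) (ξ 0))
  have hvariance := variance_fun_sub hmemLp h.memLp_size
  have hmeas : AEMeasurable (fun ω => criticalRate μ (τ 0) (ξ 0) * τ 0 ω - ξ 0 ω) μ :=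
    (hmemLp.sub h.memLp_size).1.aemeasurable
  rw [variance_of_integral_eq_zero hmeas h.integral_step_eq_zero,
    hindep.covariance_eq_zero hmemLp h.memLp_size, variance_const_mul] at hvariance
  rw [hvariance, limitVariance]
  ring

theorem mul_measure_exists_comparison_le (h : ClaimInputs μ τ ξ) {V : ℝ → ENNReal}
    (hV : Measurable V) (hx : x₁ ≤ x)
    (hstep : ∀ y ≥ x₁,
      ∫⁻ ω, V (max (y + truncJump c θ δ y (τ 0 ω) (ξ 0 ω)) x₁) ∂μ ≤ V y) :
    V x₁ * μ {ω | ∃ n,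
      drivenChain (comparisonStep c θ δ x₁) (fun n ω => (τ n ω, ξ n ω)) x n ω ∈ Set.Iic x₁} ≤
        V x := by
  refine (mul_measure_exists_drivenChain_mem_le (V := fun y => V (max y x₁))
    (measurable_comparisonStep c θ δ x₁) h.measurable_pair h.indep_priorSigma h.identDistrib_pair
    (by fun_prop) (fun y => ?_) (fun y hy p => ?_) (fun y hy => ?_) x).trans_eq ?_
  · rcases lt_or_ge x₁ y with hy | hy
    · simpa only [comparisonStep, if_pos hy, max_eq_left hy.le] using hstep y hy.le
    · simp [comparisonStep, hy.not_gt]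
  · rwa [comparisonStep, if_neg (not_lt.2 hy)]
  · rw [max_eq_right hy]
  · rw [max_eq_left hx]

theorem lyapunov_mul_ruinProb_le (h : ClaimInputs μ τ ξ) (hv : ∀ y, 0 ≤ v y) {R : ℝ → Ω → ℝ}
    (hR : IsRiskReserve μ v τ ξ x R) (hc : 0 ≤ c) (hθ : 0 ≤ θ) (hδ : 0 ≤ δ) (hx₁ : 1 ≤ x₁)
    (hx : x₁ ≤ x)
    (hrate : ∀ y ≥ x₁, ∀ r ∈ Set.Icc y (y + (c + θ) * (δ * y)), c + θ / y ≤ v r)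
    (hstep : ∀ y ≥ x₁, ∫⁻ ω, ENNReal.ofReal (lyapunov (μ.map (ξ 0)) b
        (max (y + truncJump c θ δ y (τ 0 ω) (ξ 0 ω)) x₁)) ∂μ ≤
      ENNReal.ofReal (lyapunov (μ.map (ξ 0)) b y)) :
    lyapunov (μ.map (ξ 0)) b x₁ * ruinProb μ R ≤ lyapunov (μ.map (ξ 0)) b x := by
  have hruin : {ω | ∃ t : ℝ, 0 ≤ t ∧ R t ω < 0} ≤ᵐ[μ] {ω | ∃ n, drivenChain
      (comparisonStep c θ δ x₁) (fun n ω => (τ n ω, ξ n ω)) x n ω ∈ Set.Iic x₁} := by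
    filter_upwards [h.ae_reservePath hR] with ω hpath ⟨t, ht, hneg⟩
    by_contra hnot
    have habove (n : ℕ) :
        x₁ < drivenChain (comparisonStep c θ δ x₁) (fun n ω => (τ n ω, ξ n ω)) x n ω :=
      not_le.1 fun hle => hnot ⟨n, hle⟩
    refine hneg.not_ge (hpath.nonneg hv (fun n => ?_) ht)
    linarith [habove n,
      hpath.drivenChain_comparisonStep_le hv hc hθ hδ hx₁ hrate habove n]
  have hbound := (mul_le_mul_right (measure_mono_ae hruin) _).trans
    (h.mul_measure_exists_comparison_le (measurable_lyapunov b).ennreal_ofReal hx hstep)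
  rw [← ofReal_measureReal, ← ENNReal.ofReal_mul (lyapunov_nonneg _ _ _)] at hbound
  exact (ENNReal.ofReal_le_ofReal_iff (lyapunov_nonneg _ _ _)).1 hbound

theorem exists_ruinProb_le (h : ClaimInputs μ τ ξ) (hv : ∀ y, 0 ≤ v y) {R : ℝ → ℝ → Ω → ℝ}
    (hR : ∀ x : ℝ, 0 < x → IsRiskReserve μ v τ ξ x (R x))
    (hrate : Tendsto (fun z => z * (v z - criticalRate μ (τ 0) (ξ 0))) atTop (𝓝 θ))
    (hb : 0 < b) (hbρ : b < ruinExponent μ (τ 0) (ξ 0) θ)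
    (hF₀ : ∀ x, 0 < μ.real {ω | x < ξ 0 ω})
    (hlt : DoublingLT (fun x => μ.real {ω | x < ξ 0 ω}) (-2))
    (hgt : DoublingGT (fun x => μ.real {ω | x < ξ 0 ω}) (-(2 + b))) :
    ∃ C > 0, ∀ᶠ x in atTop, ruinProb μ (R x) ≤ C * (x ^ 2 * μ.real {ω | x < ξ 0 ω}) := by
  have hmap := measureReal_map_Ioi (h.meas_size 0).aemeasurable (μ := μ)
  simp only [← hmap] at hF₀ hlt hgt ⊢
  obtain ⟨κ, hκ, θ', ⟨hθ'₀, hθ'⟩, hdrift⟩ := h.exists_slope_lt hb hbρ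
  rw [← h.integral_step_sq_eq] at hdrift
  obtain ⟨δ₁, hδ₁, hstep⟩ := exists_lintegral_lyapunov_le h.memLp_time h.memLp_size (h.meas_size 0)
    (h.nonneg_time 0) (h.nonneg_size 0) h.integral_size_eq h.criticalRate_nonneg hθ'₀.le hb hκ
    hdrift hgt
  obtain ⟨δ₂, hδ₂, hrate⟩ := exists_le_rate_on_Icc hrate h.criticalRate_nonneg hθ'₀ hθ'
  have hδ := lt_min hδ₁ hδ₂
  obtain ⟨x₁, hstep, hrate, hx₁⟩ := ((hstep _ ⟨hδ, min_le_left _ _⟩).and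
    ((hrate _ (min_le_right _ _)).and (eventually_ge_atTop 1))).exists
  have hpos := lyapunov_pos hb.le (integrableOn_sq_map h.memLp_size) (hF₀ 0) x₁
  obtain ⟨C, hC, hle⟩ := exists_lyapunov_le hb.le hF₀ hlt hgt
  refine ⟨C / lyapunov (μ.map (ξ 0)) b x₁, div_pos hC hpos, ?_⟩
  filter_upwards [hle, eventually_ge_atTop x₁] with x hx hx₁x
  rw [div_mul_eq_mul_div, le_div_iff₀' hpos]
  exact (h.lyapunov_mul_ruinProb_le hv (hR x (by linarith)) h.criticalRate_nonneg hθ'₀.le hδ.le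
    hx₁ hx₁x hrate hstep).trans hx

end ClaimInputs

end UpperBound

section Distribution

variable {Ω : Type*} [MeasurableSpace Ω] {μ : Measure Ω}

theorem measureReal_mem_and_mem_eq_mul {S T : Type*} [MeasurableSpace S] [MeasurableSpace T]
    {X : Ω → S} {Y : Ω → T} (hXY : IndepFun X Y μ) {s : Set S} {t : Set T} (hs : MeasurableSet s)
    (ht : MeasurableSet t) :
    μ.real {ω | X ω ∈ s ∧ Y ω ∈ t} = μ.real {ω | X ω ∈ s} * μ.real {ω | Y ω ∈ t} := by
  simp only [measureReal_def, ← ENNReal.toReal_mul]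
  exact congrArg ENNReal.toReal (hXY.measure_inter_preimage_eq_mul s t hs ht)

theorem antitone_measureReal_lt [IsFiniteMeasure μ] (X : Ω → ℝ) :
    Antitone fun x => μ.real {ω | x < X ω} :=
  fun _ _ hxy => measureReal_mono fun _ hω => hxy.trans_lt hω

theorem eventually_lt_measureReal_le [IsProbabilityMeasure μ] {X : Ω → ℝ} (hX : AEMeasurable X μ)
    {p : ℝ} (hp : p < 1) : ∀ᶠ t in atTop, p < μ.real {ω | X ω ≤ t} := by
  have := Measure.isProbabilityMeasure_map hX
  filter_upwards [(tendsto_cdf_atTop (μ.map X)).eventually_const_lt hp] with t ht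
  rwa [cdf_eq_real, map_measureReal_apply_of_aemeasurable hX measurableSet_Iic] at ht

end Distribution

section DrivenChain

variable {Ω E S : Type*} [MeasurableSpace E] [MeasurableSpace S] {f : E → S → E}
  {Z : ℕ → Ω → S} [MeasurableSpace Ω] {μ : Measure Ω} {B : Set E} {G : Set S}

theorem measureReal_drivenChain_mem_and (hf : Measurable (Function.uncurry f))
    (hZ : ∀ n, Indep (priorSigma Z n) (MeasurableSpace.comap (Z n) inferInstance) μ)
    (hZ_ident : ∀ n, IdentDistrib (Z n) (Z 0) μ μ) (hB : MeasurableSet B) (hG : MeasurableSet G)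
    (y : E) (n : ℕ) :
    μ.real {ω | drivenChain f Z y n ω ∈ B ∧ Z n ω ∈ G} =
      μ.real {ω | drivenChain f Z y n ω ∈ B} * μ.real {ω | Z 0 ω ∈ G} := by
  rw [measureReal_mem_and_mem_eq_mul (indepFun_drivenChain hf hZ y n) hB hG]
  exact congrArg _ (congrArg ENNReal.toReal ((hZ_ident n).measure_mem_eq hG))

variable [IsProbabilityMeasure μ]

theorem mul_le_measureReal_exists_drivenChain_mem_and (hf : Measurable (Function.uncurry f))
    (hZ_meas : ∀ n, Measurable (Z n))
    (hZ : ∀ n, Indep (priorSigma Z n) (MeasurableSpace.comap (Z n) inferInstance) μ)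
    (hZ_ident : ∀ n, IdentDistrib (Z n) (Z 0) μ μ) (hB : MeasurableSet B) (hG : MeasurableSet G)
    {y : E} (hexit : ∀ i j ω, i < j → Z i ω ∈ G → drivenChain f Z y j ω ∉ B) {n : ℕ} {p : ℝ}
    (hp : ∀ k < n, p ≤ μ.real {ω | drivenChain f Z y k ω ∈ B}) :
    n * (p * μ.real {ω | Z 0 ω ∈ G}) ≤
      μ.real {ω | ∃ k < n, drivenChain f Z y k ω ∈ B ∧ Z k ω ∈ G} := by
  have hdisj : Set.PairwiseDisjoint (Finset.range n : Set ℕ)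
      fun k => {ω | drivenChain f Z y k ω ∈ B ∧ Z k ω ∈ G} :=
    Pairwise.set_pairwise ((pairwise_disjoint_on _).2 fun i j hij =>
      Set.disjoint_left.2 fun ω hi hj => hexit i j ω hij hi.2 hj.1) _
  have hmeas (k : ℕ) : MeasurableSet {ω | drivenChain f Z y k ω ∈ B ∧ Z k ω ∈ G} :=
    (measurable_drivenChain hf hZ_meas y k hB).inter (hZ_meas k hG)
  have hunion : {ω | ∃ k < n, drivenChain f Z y k ω ∈ B ∧ Z k ω ∈ G} =
      ⋃ k ∈ Finset.range n, {ω | drivenChain f Z y k ω ∈ B ∧ Z k ω ∈ G} := by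
    ext ω
    simp only [Set.mem_iUnion, Finset.mem_range, exists_prop, Set.mem_ofPred_eq]
  rw [hunion, measureReal_biUnion_finset hdisj fun k _ => hmeas k, ← nsmul_eq_mul]
  simpa only [Finset.card_range] using Finset.card_nsmul_le_sum (Finset.range n) _ _ fun k hk => by
    rw [measureReal_drivenChain_mem_and hf hZ hZ_ident hB hG]
    exact mul_le_mul_of_nonneg_right (hp k (Finset.mem_range.1 hk)) measureReal_nonneg

end DrivenChain

section ReflectedWalk

/-- The step of a pair `(d, q)`, where `d` is the random walk with increments `c t - s` reflected at
`0` and `q` accumulates `|t| + s ^ 2`. -/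
def reflectedStep (c : ℝ) (y p : ℝ × ℝ) : ℝ × ℝ :=
  (max (y.1 + (c * p.1 - p.2)) 0, y.2 + (|p.1| + p.2 ^ 2))

theorem measurable_reflectedStep (c : ℝ) : Measurable (Function.uncurry (reflectedStep c)) := by
  unfold Function.uncurry reflectedStep
  fun_prop

variable {Ω : Type*} {τ ξ : ℕ → Ω → ℝ} {c x e C : ℝ} {ω : Ω}

/-- The reflected walk driven by the inter-claim times and the claims, started at `0`. -/
abbrev reflectedWalk (c : ℝ) (τ ξ : ℕ → Ω → ℝ) : ℕ → Ω → ℝ × ℝ :=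
  drivenChain (reflectedStep c) (fun n ω => (τ n ω, ξ n ω)) 0

theorem reflectedWalk_fst_nonneg (c : ℝ) (τ ξ : ℕ → Ω → ℝ) (n : ℕ) (ω : Ω) :
    0 ≤ (reflectedWalk c τ ξ n ω).1 := by
  cases n with
  | zero => exact le_rfl
  | succ n => exact le_max_right _ _

theorem reflectedWalk_snd (c : ℝ) (τ ξ : ℕ → Ω → ℝ) (n : ℕ) (ω : Ω) :
    (reflectedWalk c τ ξ n ω).2 = ∑ i ∈ Finset.range n, (|τ i ω| + ξ i ω ^ 2) := by
  induction n with
  | zero => rfl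
  | succ n ih => rw [Finset.sum_range_succ, ← ih, reflectedWalk, drivenChain, reflectedStep]

theorem sq_le_reflectedWalk_snd (c : ℝ) (τ ξ : ℕ → Ω → ℝ) {i n : ℕ} (hi : i < n) (ω : Ω) :
    ξ i ω ^ 2 ≤ (reflectedWalk c τ ξ n ω).2 := by
  rw [reflectedWalk_snd]
  exact (le_add_of_nonneg_left (abs_nonneg _)).trans (Finset.single_le_sum
    (f := fun i => |τ i ω| + ξ i ω ^ 2) (fun i _ => by positivity) (Finset.mem_range.2 hi))

theorem claimEpoch_le_reflectedWalk_snd (c : ℝ) (τ ξ : ℕ → Ω → ℝ) (n : ℕ) (ω : Ω) :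
    claimEpoch τ n ω ≤ (reflectedWalk c τ ξ n ω).2 := by
  rw [reflectedWalk_snd]
  exact Finset.sum_le_sum fun i _ => (le_abs_self _).trans (le_add_of_nonneg_right (sq_nonneg _))

namespace ReservePath

variable {v : ℝ → ℝ} {R : ℝ → Ω → ℝ}

theorem postClaim_le_reflectedWalk (h : ReservePath v τ ξ x R ω) (hv : ∀ y, 0 ≤ v y) (hc : 0 ≤ c)
    (he : 0 ≤ e) (hvc : ∀ r ≥ x, v r ≤ c + e) (n : ℕ) :
    postClaim v τ ξ x R n ω ≤ x + (reflectedWalk c τ ξ n ω).1 + e * claimEpoch τ n ω := by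
  induction n with
  | zero => simp [postClaim_zero, reflectedWalk, drivenChain, claimEpoch]
  | succ n ih =>
    have hstep := h.postClaim_succ_le hv n (add_nonneg hc he) hvc
    have hfst := reflectedWalk_fst_nonneg c τ ξ n ω
    have hdrift := mul_nonneg he (claimEpoch_nonneg h.time_nonneg n)
    have hmax : max (postClaim v τ ξ x R n ω) x ≤
        x + (reflectedWalk c τ ξ n ω).1 + e * claimEpoch τ n ω := max_le ih (by linarith)
    have hwalk : (reflectedWalk c τ ξ n ω).1 + (c * τ n ω - ξ n ω) ≤
        (reflectedWalk c τ ξ (n + 1) ω).1 := le_max_left _ _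
    rw [claimEpoch_succ]
    linarith

theorem postClaim_succ_neg (h : ReservePath v τ ξ x R ω) (hv : ∀ y, 0 ≤ v y) (hc : 0 ≤ c)
    (hC : 0 ≤ C) (hx : 1 ≤ x) (hvc : ∀ r ≥ x, v r ≤ c + C / x) {n : ℕ}
    (hwalk : reflectedWalk c τ ξ n ω ≤ (x, x ^ 2)) (hτ : τ n ω ≤ x)
    (hξ : (2 + 2 * C + c) * x < ξ n ω) : postClaim v τ ξ x R (n + 1) ω < 0 := by
  have hx₀ : 0 < x := one_pos.trans_le hx
  have hrate : 0 ≤ C / x := by positivity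
  have hpost := h.postClaim_le_reflectedWalk hv hc hrate hvc n
  have hdrift : C / x * claimEpoch τ n ω ≤ C * x := by
    calc C / x * claimEpoch τ n ω ≤ C / x * x ^ 2 := by
          gcongr
          exact (claimEpoch_le_reflectedWalk_snd c τ ξ n ω).trans hwalk.2
      _ = C * x := by field_simp
  have hmax : max (postClaim v τ ξ x R n ω) x ≤ (2 + C) * x :=
    max_le (by linarith [hwalk.1]) (by nlinarith)
  have hgrowth : (c + C / x) * τ n ω ≤ (c + C) * x := by
    gcongr
    · exact h.time_nonneg n
    · exact div_le_self hC hx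
  linarith [h.postClaim_succ_le hv n (add_nonneg hc hrate) hvc]

end ReservePath

end ReflectedWalk

section LowerBound

variable {Ω : Type*} [MeasurableSpace Ω] {μ : Measure Ω} {τ ξ : ℕ → Ω → ℝ}
  {v : ℝ → ℝ} {x θ C : ℝ}

namespace ClaimInputs

theorem measureReal_time_le_and_lt_size (h : ClaimInputs μ τ ξ) (s x : ℝ) :
    μ.real {ω | τ 0 ω ≤ s ∧ x < ξ 0 ω} = μ.real {ω | τ 0 ω ≤ s} * μ.real {ω | x < ξ 0 ω} :=
  measureReal_mem_and_mem_eq_mul (h.indepFun_time_size 0 0) measurableSet_Iic measurableSet_Ioi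

variable [IsProbabilityMeasure μ]

theorem integrable_add_step_sq (h : ClaimInputs μ τ ξ) (d : ℝ) :
    Integrable (fun ω => (d + (criticalRate μ (τ 0) (ξ 0) * τ 0 ω - ξ 0 ω)) ^ 2) μ :=
  ((memLp_const d).add ((h.memLp_time.const_mul _).sub h.memLp_size)).integrable_sq

theorem integral_add_step_sq (h : ClaimInputs μ τ ξ) (d : ℝ) :
    ∫ ω, (d + (criticalRate μ (τ 0) (ξ 0) * τ 0 ω - ξ 0 ω)) ^ 2 ∂μ =
      d ^ 2 + limitVariance μ (τ 0) (ξ 0) := by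
  set J : Ω → ℝ := fun ω => criticalRate μ (τ 0) (ξ 0) * τ 0 ω - ξ 0 ω
  have hJ : MemLp J 2 μ := (h.memLp_time.const_mul _).sub h.memLp_size
  have hlinear : Integrable (fun ω => 2 * d * J ω) μ := (hJ.integrable one_le_two).const_mul _
  have haffine : Integrable (fun ω => d ^ 2 + 2 * d * J ω) μ := (integrable_const _).add hlinear
  calc ∫ ω, (d + J ω) ^ 2 ∂μ = ∫ ω, (d ^ 2 + 2 * d * J ω + J ω ^ 2) ∂μ := by
        congr with ω
        ring
    _ = d ^ 2 + 2 * d * ∫ ω, J ω ∂μ + ∫ ω, J ω ^ 2 ∂μ := by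
        rw [integral_add haffine hJ.integrable_sq,
          integral_add (integrable_const _) hlinear, integral_const_mul, integral_const,
          probReal_univ, one_smul]
    _ = d ^ 2 + limitVariance μ (τ 0) (ξ 0) := by
        rw [h.integral_step_eq_zero, h.integral_step_sq_eq, mul_zero, add_zero]

theorem lintegral_reflectedStep_le (h : ClaimInputs μ τ ξ) (y : ℝ × ℝ) :
    ∫⁻ ω, (ENNReal.ofReal ((reflectedStep (criticalRate μ (τ 0) (ξ 0)) y (τ 0 ω, ξ 0 ω)).1 ^ 2) +
      ENNReal.ofReal (reflectedStep (criticalRate μ (τ 0) (ξ 0)) y (τ 0 ω, ξ 0 ω)).2) ∂μ ≤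
    ENNReal.ofReal (y.1 ^ 2) + ENNReal.ofReal y.2 + ENNReal.ofReal
      (limitVariance μ (τ 0) (ξ 0) + ∫ ω, (|τ 0 ω| + ξ 0 ω ^ 2) ∂μ) := by
  set J : Ω → ℝ := fun ω => criticalRate μ (τ 0) (ξ 0) * τ 0 ω - ξ 0 ω
  set Q : Ω → ℝ := fun ω => |τ 0 ω| + ξ 0 ω ^ 2
  have hQ : Integrable Q μ :=
    (h.memLp_time.integrable one_le_two).abs.add h.memLp_size.integrable_sq
  have hQ₀ (ω : Ω) : 0 ≤ Q ω := by positivity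
  have hreflect (ω : Ω) : max (y.1 + J ω) 0 ^ 2 ≤ (y.1 + J ω) ^ 2 := by
    rcases max_cases (y.1 + J ω) 0 with ⟨hmax, -⟩ | ⟨hmax, -⟩ <;> rw [hmax]
    simpa using sq_nonneg _
  calc _ ≤ ∫⁻ ω, (ENNReal.ofReal ((y.1 + J ω) ^ 2) +
        (ENNReal.ofReal y.2 + ENNReal.ofReal (Q ω))) ∂μ :=
        lintegral_mono fun ω => add_le_add (ENNReal.ofReal_le_ofReal (hreflect ω))
          ENNReal.ofReal_add_le
    _ = ENNReal.ofReal (y.1 ^ 2 + limitVariance μ (τ 0) (ξ 0)) +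
        (ENNReal.ofReal y.2 + ENNReal.ofReal (∫ ω, Q ω ∂μ)) := by
        have hsquare := h.integrable_add_step_sq y.1
        rw [lintegral_add_left' hsquare.aemeasurable.ennreal_ofReal,
          lintegral_add_left measurable_const,
          ← ofReal_integral_eq_lintegral_ofReal hsquare (.of_forall fun ω => sq_nonneg _),
          ← ofReal_integral_eq_lintegral_ofReal hQ (.of_forall hQ₀), h.integral_add_step_sq,
          lintegral_const, measure_univ, mul_one]
    _ = _ := by
        rw [ENNReal.ofReal_add (sq_nonneg _) (limitVariance_nonneg _ _ _),
          ENNReal.ofReal_add (limitVariance_nonneg _ _ _) (integral_nonneg hQ₀)]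
        ring

theorem exists_half_le_measureReal_reflectedWalk (h : ClaimInputs μ τ ξ) :
    ∃ K > 0, ∀ (n : ℕ) (x : ℝ), 0 < x → n * K ≤ x ^ 2 → 1 / 2 ≤ μ.real
      {ω | reflectedWalk (criticalRate μ (τ 0) (ξ 0)) τ ξ n ω ∈ Set.Iic (x, x ^ 2)} := by
  set c := criticalRate μ (τ 0) (ξ 0)
  set K := limitVariance μ (τ 0) (ξ 0) + ∫ ω, (|τ 0 ω| + ξ 0 ω ^ 2) ∂μ
  have hK₀ : 0 ≤ K :=
    add_nonneg (limitVariance_nonneg _ _ _) (integral_nonneg fun ω => by positivity)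
  refine ⟨2 * K + 1, by positivity, fun n x hx hnx => ?_⟩
  let V (y : ℝ × ℝ) : ENNReal := ENNReal.ofReal (y.1 ^ 2) + ENNReal.ofReal y.2
  have hV : Measurable V := by fun_prop
  have hwalk : Measurable (reflectedWalk c τ ξ n) :=
    measurable_drivenChain (measurable_reflectedStep c) h.measurable_pair 0 n
  have hmeas : MeasurableSet {ω | reflectedWalk c τ ξ n ω ∈ Set.Iic (x, x ^ 2)} :=
    hwalk measurableSet_Iic
  have henergy : ∫⁻ ω, V (reflectedWalk c τ ξ n ω) ∂μ ≤ n * ENNReal.ofReal K := by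
    simpa [V] using lintegral_drivenChain_le (measurable_reflectedStep c) h.measurable_pair
      h.indep_priorSigma h.identDistrib_pair hV h.lintegral_reflectedStep_le 0 n
  have hexit : {ω | reflectedWalk c τ ξ n ω ∈ Set.Iic (x, x ^ 2)}ᶜ ⊆
      {ω | ENNReal.ofReal (x ^ 2) ≤ V (reflectedWalk c τ ξ n ω)} := by
    intro ω hω
    rcases not_and_or.1 hω with hfst | hsnd
    · exact (ENNReal.ofReal_le_ofReal (pow_le_pow_left₀ hx.le (not_le.1 hfst).le 2)).trans
        le_self_add
    · exact (ENNReal.ofReal_le_ofReal (not_le.1 hsnd).le).trans le_add_self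
  have hmarkov := (mul_le_mul_right (measure_mono hexit) _).trans
    ((mul_meas_ge_le_lintegral (hV.comp hwalk) (ENNReal.ofReal (x ^ 2))).trans henergy)
  rw [← ofReal_measureReal, ← ENNReal.ofReal_mul (sq_nonneg x), ← ENNReal.ofReal_natCast,
    ← ENNReal.ofReal_mul n.cast_nonneg, ENNReal.ofReal_le_ofReal_iff (by positivity),
    probReal_compl_eq_one_sub hmeas] at hmarkov
  by_contra! hlt
  nlinarith [sq_pos_of_pos hx, (Nat.cast_nonneg n : (0 : ℝ) ≤ n)]

theorem measureReal_le_ruinProb (h : ClaimInputs μ τ ξ) {R : ℝ → Ω → ℝ}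
    (hR : IsRiskReserve μ v τ ξ x R) {A : Set Ω}
    (hA : ∀ ω ∈ A, ReservePath v τ ξ x R ω → ∃ n, postClaim v τ ξ x R n ω < 0) :
    μ.real A ≤ ruinProb μ R := by
  have hruin : A ≤ᵐ[μ] {ω | ∃ t : ℝ, 0 ≤ t ∧ R t ω < 0} := by
    filter_upwards [h.ae_reservePath hR] with ω hpath hω
    obtain ⟨n, hn⟩ := hA ω hω hpath
    exact hpath.exists_neg hn
  exact ENNReal.toReal_mono (measure_ne_top _ _) (measure_mono_ae hruin)

theorem mul_le_ruinProb (h : ClaimInputs μ τ ξ) (hv : ∀ y, 0 ≤ v y) {R : ℝ → Ω → ℝ}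
    (hR : IsRiskReserve μ v τ ξ x R) (hC : 0 ≤ C) (hx : 1 ≤ x)
    (hvc : ∀ r ≥ x, v r ≤ criticalRate μ (τ 0) (ξ 0) + C / x) {n : ℕ} {p : ℝ}
    (hp : ∀ k < n, p ≤ μ.real
      {ω | reflectedWalk (criticalRate μ (τ 0) (ξ 0)) τ ξ k ω ∈ Set.Iic (x, x ^ 2)}) :
    n * (p * (μ.real {ω | τ 0 ω ≤ x} *
      μ.real {ω | (2 + 2 * C + criticalRate μ (τ 0) (ξ 0)) * x < ξ 0 ω})) ≤ ruinProb μ R := by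
  have hc := h.criticalRate_nonneg
  set c := criticalRate μ (τ 0) (ξ 0)
  have hexit (i j : ℕ) (ω : Ω) (hij : i < j)
      (hi : (τ i ω, ξ i ω) ∈ Set.Iic x ×ˢ Set.Ioi ((2 + 2 * C + c) * x)) :
      reflectedWalk c τ ξ j ω ∉ Set.Iic (x, x ^ 2) := by
    have hlarge : x < ξ i ω := lt_of_le_of_lt (by nlinarith) hi.2
    intro hj
    exact (hj.2.trans_lt (pow_lt_pow_left₀ hlarge (by linarith) two_ne_zero)).not_ge
      (sq_le_reflectedWalk_snd c τ ξ hij ω)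
  rw [← h.measureReal_time_le_and_lt_size]
  refine (mul_le_measureReal_exists_drivenChain_mem_and (measurable_reflectedStep c)
    h.measurable_pair h.indep_priorSigma h.identDistrib_pair measurableSet_Iic
    (measurableSet_Iic.prod measurableSet_Ioi) hexit hp).trans
    (h.measureReal_le_ruinProb hR ?_)
  rintro ω ⟨k, -, hwalk, hτ, hξ⟩ hpath
  exact ⟨k + 1, hpath.postClaim_succ_neg hv hc hC hx hvc hwalk hτ hξ⟩

theorem exists_le_ruinProb (h : ClaimInputs μ τ ξ) (hv : ∀ y, 0 ≤ v y) {R : ℝ → ℝ → Ω → ℝ}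
    (hR : ∀ x : ℝ, 0 < x → IsRiskReserve μ v τ ξ x (R x))
    (hrate : Tendsto (fun z => z * (v z - criticalRate μ (τ 0) (ξ 0))) atTop (𝓝 θ)) {a : ℝ}
    (hgt : DoublingGT (fun x => μ.real {ω | x < ξ 0 ω}) a) :
    ∃ c > 0, ∀ᶠ x in atTop, c * (x ^ 2 * μ.real {ω | x < ξ 0 ω}) ≤ ruinProb μ (R x) := by
  set C := max θ 0 + 1
  obtain ⟨hθC, hC⟩ : θ < C ∧ 0 < C :=
    ⟨(le_max_left θ 0).trans_lt (lt_add_one _), by positivity⟩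
  obtain ⟨K, hK, hwalk⟩ := h.exists_half_le_measureReal_reflectedWalk
  obtain ⟨c, hc, htail⟩ := hgt.exists_mul_le_comp_mul (antitone_measureReal_lt _)
    (2 + 2 * C + criticalRate μ (τ 0) (ξ 0))
  refine ⟨c / (8 * K), by positivity, ?_⟩
  filter_upwards [htail, eventually_forall_rate_le hrate hθC hC.le, eventually_ge_atTop 1,
    eventually_lt_measureReal_le (μ := μ) (h.meas_time 0).aemeasurable one_half_lt_one,
    (tendsto_pow_atTop two_ne_zero).eventually_ge_atTop (2 * K)] with x htail hvc hx hτ hxK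
  have hx₀ : 0 < x := one_pos.trans_le hx
  have hnK : ⌊x ^ 2 / K⌋₊ * K ≤ x ^ 2 :=
    (le_div_iff₀ hK).1 (Nat.floor_le (by positivity))
  have hn : x ^ 2 / (2 * K) ≤ ⌊x ^ 2 / K⌋₊ := by
    have hlarge : 1 ≤ x ^ 2 / (2 * K) := (one_le_div (by positivity)).2 hxK
    have hhalf : x ^ 2 / K = 2 * (x ^ 2 / (2 * K)) := by field_simp
    linarith [Nat.lt_floor_add_one (x ^ 2 / K)]
  calc c / (8 * K) * (x ^ 2 * μ.real {ω | x < ξ 0 ω})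
      = x ^ 2 / (2 * K) * (1 / 2 * (1 / 2 * (c * μ.real {ω | x < ξ 0 ω}))) := by
        field_simp
        ring
    _ ≤ _ := by gcongr
    _ ≤ ruinProb μ (R x) := h.mul_le_ruinProb hv (hR x hx₀) hC.le hx hvc fun k hk =>
        hwalk k x hx₀ (le_trans (by gcongr) hnK)

theorem exists_forall_le_ruinProb (h : ClaimInputs μ τ ξ) (hv : ∀ y, 0 ≤ v y)
    {R : ℝ → ℝ → Ω → ℝ} (hR : ∀ x : ℝ, 0 < x → IsRiskReserve μ v τ ξ x (R x))
    (hrate : Tendsto (fun z => z * (v z - criticalRate μ (τ 0) (ξ 0))) atTop (𝓝 θ))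
    (hF₀ : ∀ x, 0 < μ.real {ω | x < ξ 0 ω}) (X : ℝ) :
    ∃ c > 0, ∀ x ∈ Set.Ioc 0 X, c ≤ ruinProb μ (R x) := by
  have hθ : θ < max θ 0 + 1 := (le_max_left θ 0).trans_lt (lt_add_one _)
  obtain ⟨y, hvy, hy⟩ := ((eventually_forall_rate_le hrate hθ (by positivity)).and
    (eventually_gt_atTop 0)).exists
  have hM : 0 ≤ criticalRate μ (τ 0) (ξ 0) + (max θ 0 + 1) / y :=
    add_nonneg h.criticalRate_nonneg (by positivity)
  set M := criticalRate μ (τ 0) (ξ 0) + (max θ 0 + 1) / y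
  obtain ⟨s, hs⟩ :=
    (eventually_lt_measureReal_le (μ := μ) (h.meas_time 0).aemeasurable zero_lt_one).exists
  refine ⟨_, mul_pos hs (hF₀ (max X y + M * s)), fun x hx => ?_⟩
  rw [← h.measureReal_time_le_and_lt_size]
  refine h.measureReal_le_ruinProb (hR x hx.1) fun ω ⟨hτ, hξ⟩ hpath => ⟨1, ?_⟩
  have hpost := hpath.postClaim_succ_le hv 0 hM hvy
  rw [postClaim_zero, zero_add] at hpost
  have hstart : max x y ≤ max X y := max_le_max_right y hx.2
  have hincome := mul_le_mul_of_nonneg_left hτ hM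
  linarith

end ClaimInputs

end LowerBound

section RateLimit

theorem tendsto_id_mul_zero_of_antitoneOn {p : ℝ → ℝ} {a : ℝ} (hp : ∀ z, a < z → 0 ≤ p z)
    (hanti : AntitoneOn p (Set.Ioi a)) (hint : IntegrableAtFilter p atTop volume) :
    Tendsto (fun z => z * p z) atTop (𝓝 0) := by
  obtain ⟨s, hs, hint⟩ := hint
  obtain ⟨A, hA⟩ := mem_atTop_sets.1 hs
  have hIoi : IntegrableOn p (Set.Ioi A) := hint.mono_set fun z hz => hA z (le_of_lt hz)
  have hinterval {u : ℝ} (hu : A ≤ u) : IntervalIntegrable p volume A u :=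
    (intervalIntegrable_iff_integrableOn_Ioc_of_le hu).2 (hIoi.mono_set Set.Ioc_subset_Ioi_self)
  have htail : Tendsto (fun z => 2 * ((∫ y in A..z, p y) - ∫ y in A..z / 2, p y)) atTop (𝓝 0) := by
    have hlim := intervalIntegral_tendsto_integral_Ioi A hIoi tendsto_id
    simpa using (hlim.sub (hlim.comp (tendsto_id.atTop_div_const two_pos))).const_mul 2
  refine squeeze_zero' ?_ ?_ htail
  · filter_upwards [eventually_gt_atTop a, eventually_ge_atTop 0] with z hz hz₀
    exact mul_nonneg hz₀ (hp z hz)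
  · filter_upwards [eventually_gt_atTop (2 * a), eventually_ge_atTop (2 * A),
      eventually_gt_atTop a, eventually_ge_atTop A, eventually_ge_atTop 0] with z ha hA ha' hA' hz₀
    have hhalf := hinterval (show A ≤ z / 2 by linarith)
    have hblock : ∫ _ in z / 2..z, p z ≤ ∫ y in z / 2..z, p y := by
      refine intervalIntegral.integral_mono_on (by linarith) intervalIntegrable_const
        (hhalf.symm.trans (hinterval hA')) fun y hy => ?_
      exact hanti (show a < y by linarith [hy.1]) ha' hy.2
    rw [intervalIntegral.integral_const, smul_eq_mul] at hblock
    rw [intervalIntegral.integral_interval_sub_left (hinterval hA') hhalf]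
    linarith

theorem ApproachesAtRate.tendsto_mul_sub {v : ℝ → ℝ} {c θ : ℝ} (h : ApproachesAtRate v c θ) :
    Tendsto (fun z => z * (v z - c)) atTop (𝓝 θ) := by
  obtain ⟨p, hp, hanti, hint, hv⟩ := h
  rw [tendsto_iff_norm_sub_tendsto_zero]
  refine squeeze_zero' (.of_forall fun z => norm_nonneg _) ?_
    (tendsto_id_mul_zero_of_antitoneOn (fun z hz => (hp z hz).le) hanti hint)
  filter_upwards [eventually_gt_atTop 1] with z hz
  have hz₀ : 0 < z := one_pos.trans hz
  have hfactor : z * (v z - c) - θ = z * (v z - c - θ / z) := by field_simp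
  calc ‖z * (v z - c) - θ‖ = z * |v z - c - θ / z| := by
        rw [hfactor, Real.norm_eq_abs, abs_mul, abs_of_pos hz₀]
    _ ≤ z * p z := by
        gcongr
        exact hv z hz

end RateLimit

section Comparison

open Asymptotics

variable {f g : ℝ → ℝ} {S : Set ℝ}

/-- Below every level, `f` is bounded and bounded away from `0` on `S`. An asymptotic comparison at
infinity between two such functions extends to all of `S`. -/
def PinchedBelow (f : ℝ → ℝ) (S : Set ℝ) : Prop :=
  ∀ X, ∃ m M, 0 < m ∧ ∀ x ∈ S, x ≤ X → m ≤ f x ∧ f x ≤ M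

theorem PinchedBelow.mono {S' : Set ℝ} (h : PinchedBelow f S) (hS : S' ⊆ S) :
    PinchedBelow f S' := fun X =>
  let ⟨m, M, hm, hf⟩ := h X
  ⟨m, M, hm, fun x hx => hf x (hS hx)⟩

theorem PinchedBelow.exists_le_mul (hf : PinchedBelow f S) (hg : PinchedBelow g S)
    (h : f =O[atTop] g) : ∃ C > 0, ∀ x ∈ S, f x ≤ C * g x := by
  obtain ⟨C, hC, hfg⟩ := h.exists_pos
  obtain ⟨X, hX⟩ := eventually_atTop.1 hfg.bound
  obtain ⟨_, M, _, hM⟩ := hf X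
  obtain ⟨m, _, hm, hmg⟩ := hg X
  refine ⟨max C (M / m), lt_max_of_lt_left hC, fun x hx => ?_⟩
  have hgx : 0 ≤ g x := let ⟨_, _, hpos, hle⟩ := hg x; hpos.le.trans (hle x hx le_rfl).1
  rcases le_total X x with hXx | hxX
  · calc f x ≤ ‖f x‖ := Real.le_norm_self _
      _ ≤ C * ‖g x‖ := hX x hXx
      _ = C * g x := by rw [Real.norm_of_nonneg hgx]
      _ ≤ max C (M / m) * g x := by
          gcongr
          exact le_max_left _ _
  · calc f x ≤ M := (hM x hx hxX).2
      _ = M / m * m := (div_mul_cancel₀ _ hm.ne').symm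
      _ ≤ max C (M / m) * g x :=
          mul_le_mul (le_max_right _ _) (hmg x hx hxX).1 hm.le (le_max_of_le_left hC.le)

theorem PinchedBelow.exists_mul_le_and_le_mul (hf : PinchedBelow f S) (hg : PinchedBelow g S)
    (h : f =Θ[atTop] g) :
    ∃ C₁ C₂ : ℝ, 0 < C₁ ∧ 0 < C₂ ∧ ∀ x ∈ S, C₁ * g x ≤ f x ∧ f x ≤ C₂ * g x := by
  obtain ⟨C, hC, hgf⟩ := hg.exists_le_mul hf h.isBigO_symm
  obtain ⟨C₂, hC₂, hfg⟩ := hf.exists_le_mul hg h.isBigO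
  exact ⟨C⁻¹, C₂, inv_pos.2 hC, hC₂, fun x hx => ⟨(inv_mul_le_iff₀ hC).2 (hgf x hx), hfg x hx⟩⟩

theorem isTheta_of_exists_mul_le (hg : ∀ᶠ x in atTop, 0 ≤ g x)
    (hlower : ∃ c > 0, ∀ᶠ x in atTop, c * g x ≤ f x)
    (hupper : ∃ C > 0, ∀ᶠ x in atTop, f x ≤ C * g x) : f =Θ[atTop] g := by
  obtain ⟨c, hc, hlower⟩ := hlower
  obtain ⟨C, -, hupper⟩ := hupper
  have hf : ∀ᶠ x in atTop, 0 ≤ f x := by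
    filter_upwards [hg, hlower] with x hgx hle using (mul_nonneg hc.le hgx).trans hle
  refine ⟨.of_bound C ?_, .of_bound c⁻¹ ?_⟩
  · filter_upwards [hf, hg, hupper] with x hfx hgx hle
    rwa [Real.norm_of_nonneg hfx, Real.norm_of_nonneg hgx]
  · filter_upwards [hf, hg, hlower] with x hfx hgx hle
    rwa [Real.norm_of_nonneg hfx, Real.norm_of_nonneg hgx, le_inv_mul_iff₀ hc]

variable {F : ℝ → ℝ}

theorem isTheta_setIntegral_id_mul (hF : Antitone F) (hF₀ : ∀ x, 0 ≤ F x)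
    (hlt : DoublingLT F (-2)) {a : ℝ} (hgt : DoublingGT F a) :
    (fun x => ∫ y in Set.Ioi x, y * F y) =Θ[atTop] fun x => x ^ 2 * F x :=
  isTheta_of_exists_mul_le (.of_forall fun x => mul_nonneg (sq_nonneg x) (hF₀ x))
    (hgt.exists_le_setIntegral_id_mul hF hF₀ (hlt.integrableOn_id_mul hF hF₀))
    (hlt.exists_setIntegral_id_mul_le hF hF₀)

theorem pinchedBelow_sq_mul (hF : Antitone F) (hF₀ : ∀ x, 0 < F x) {x₀ : ℝ} (hx₀ : 0 < x₀) :
    PinchedBelow (fun x => x ^ 2 * F x) (Set.Ici x₀) := fun X =>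
  ⟨x₀ ^ 2 * F X, X ^ 2 * F x₀, mul_pos (by positivity) (hF₀ X), fun x (hx : x₀ ≤ x) hxX =>
    ⟨mul_le_mul (pow_le_pow_left₀ hx₀.le hx 2) (hF hxX) (hF₀ X).le (sq_nonneg x),
      mul_le_mul (pow_le_pow_left₀ (hx₀.le.trans hx) hxX 2) (hF hx) (hF₀ x).le (sq_nonneg X)⟩⟩

theorem antitoneOn_setIntegral_id_mul (hF₀ : ∀ x, 0 ≤ F x)
    (hint : IntegrableOn (fun y => y * F y) (Set.Ioi 0)) :
    AntitoneOn (fun x => ∫ y in Set.Ioi x, y * F y) (Set.Ici 0) := by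
  intro x (hx : 0 ≤ x) z _ hxz
  refine setIntegral_mono_set (hint.mono_set (Set.Ioi_subset_Ioi hx)) ?_
    (Set.Ioi_subset_Ioi hxz).eventuallyLE
  filter_upwards [ae_restrict_mem measurableSet_Ioi] with y hy
  exact mul_nonneg (hx.trans hy.le) (hF₀ y)

theorem setIntegral_id_mul_pos (hF₀ : ∀ x, 0 < F x)
    (hint : IntegrableOn (fun y => y * F y) (Set.Ioi 0)) {x : ℝ} (hx : 0 ≤ x) :
    0 < ∫ y in Set.Ioi x, y * F y := by
  have hpos (y : ℝ) (hy : y ∈ Set.Ioi x) : 0 < y * F y := mul_pos (hx.trans_lt hy) (hF₀ y)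
  rw [setIntegral_pos_iff_support_of_nonneg_ae
    (ae_restrict_of_forall_mem measurableSet_Ioi fun y hy => (hpos y hy).le)
    (hint.mono_set (Set.Ioi_subset_Ioi hx))]
  have hsupport : Set.Ioi x ⊆ Function.support (fun y => y * F y) := fun y hy => (hpos y hy).ne'
  rw [Set.inter_eq_right.2 hsupport, Real.volume_Ioi]
  exact ENNReal.zero_lt_top

theorem pinchedBelow_setIntegral_id_mul (hF₀ : ∀ x, 0 < F x)
    (hint : IntegrableOn (fun y => y * F y) (Set.Ioi 0)) :
    PinchedBelow (fun x => ∫ y in Set.Ioi x, y * F y) (Set.Ioi 0) := fun X => by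
  have hanti := antitoneOn_setIntegral_id_mul (fun x => (hF₀ x).le) hint
  have hX : 0 ≤ max X 0 := le_max_right X 0
  refine ⟨_, _, setIntegral_id_mul_pos hF₀ hint hX, fun x (hx : 0 < x) hxX =>
    ⟨hanti hx.le hX (hxX.trans (le_max_left X 0)), hanti Set.self_mem_Ici hx.le hx.le⟩⟩

end Comparison

section RuinProbability

open Asymptotics

variable {Ω : Type*} [MeasurableSpace Ω] {μ : Measure Ω} [IsProbabilityMeasure μ]

theorem memLp_two_of_integrable_sq_mul_log {X : Ω → ℝ} (hX : AEStronglyMeasurable X μ)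
    (hX₀ : 0 ≤ᵐ[μ] X) (hlog : Integrable (fun ω => X ω ^ 2 * Real.log (1 + X ω)) μ) :
    MemLp X 2 μ := by
  refine (memLp_two_iff_integrable_sq hX).2
    ((hlog.add (integrable_const 4)).mono' (hX.pow 2) ?_)
  filter_upwards [hX₀] with ω (hω : 0 ≤ X ω)
  rw [Real.norm_of_nonneg (sq_nonneg _), Pi.add_apply]
  rcases le_total (X ω) 2 with hle | hge
  · have hlog₀ : 0 ≤ Real.log (1 + X ω) := Real.log_nonneg (by linarith)
    nlinarith [mul_nonneg (sq_nonneg (X ω)) hlog₀]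
  · have hlog₁ : 1 ≤ Real.log (1 + X ω) := by
      rw [Real.le_log_iff_exp_le (by linarith)]
      linarith [Real.exp_one_lt_three]
    nlinarith [sq_nonneg (X ω)]

theorem ClaimInputs.pinchedBelow_ruinProb {τ ξ : ℕ → Ω → ℝ} (h : ClaimInputs μ τ ξ) {v : ℝ → ℝ}
    (hv : ∀ y, 0 ≤ v y) {R : ℝ → ℝ → Ω → ℝ}
    (hR : ∀ x : ℝ, 0 < x → IsRiskReserve μ v τ ξ x (R x)) {θ : ℝ}
    (hrate : Tendsto (fun z => z * (v z - criticalRate μ (τ 0) (ξ 0))) atTop (𝓝 θ))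
    (hF₀ : ∀ x, 0 < μ.real {ω | x < ξ 0 ω}) :
    PinchedBelow (fun x => ruinProb μ (R x)) (Set.Ioi 0) := fun X =>
  let ⟨c, hc, hle⟩ := h.exists_forall_le_ruinProb hv hR hrate hF₀ X
  ⟨c, 1, hc, fun x hx hxX => ⟨hle x ⟨hx, hxX⟩, measureReal_le_one⟩⟩

theorem mainTheorem5_general {τ ξ : ℕ → Ω → ℝ} (h : ClaimInputs μ τ ξ) {v : ℝ → ℝ}
    (hv : ∀ y, 0 ≤ v y) {R : ℝ → ℝ → Ω → ℝ}
    (hR : ∀ x : ℝ, 0 < x → IsRiskReserve μ v τ ξ x (R x)) {θ : ℝ}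
    (hrate : Tendsto (fun z => z * (v z - criticalRate μ (τ 0) (ξ 0))) atTop (𝓝 θ)) {b : ℝ}
    (hb : b < ruinExponent μ (τ 0) (ξ 0) θ) (hF₀ : ∀ x, 0 < μ.real {ω | x < ξ 0 ω})
    (hlt : DoublingLT (fun x => μ.real {ω | x < ξ 0 ω}) (-2))
    (hgt : DoublingGT (fun x => μ.real {ω | x < ξ 0 ω}) (-(2 + b))) :
    IntegrableOn (fun y : ℝ => y * μ.real {ω | y < ξ 0 ω}) (Set.Ioi 0) ∧
    (∃ C₁ C₂ : ℝ, 0 < C₁ ∧ 0 < C₂ ∧ ∀ x : ℝ, 0 < x →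
      C₁ * (∫ y in Set.Ioi x, y * μ.real {ω | y < ξ 0 ω}) ≤ ruinProb μ (R x) ∧
      ruinProb μ (R x) ≤ C₂ * ∫ y in Set.Ioi x, y * μ.real {ω | y < ξ 0 ω}) ∧
    (∀ x₀ : ℝ, 0 < x₀ → ∃ C₁ C₂ : ℝ, 0 < C₁ ∧ 0 < C₂ ∧ ∀ x : ℝ, x₀ ≤ x →
      C₁ * (x ^ 2 * μ.real {ω | x < ξ 0 ω}) ≤ ruinProb μ (R x) ∧
      ruinProb μ (R x) ≤ C₂ * (x ^ 2 * μ.real {ω | x < ξ 0 ω})) := by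
  have hb₀ : 0 < b := by linarith [hgt.lt_of_doublingLT hlt hF₀]
  have hanti := antitone_measureReal_lt (μ := μ) (ξ 0)
  have hnonneg (x : ℝ) := (hF₀ x).le
  have hint := hlt.integrableOn_id_mul hanti hnonneg
  have hruin := h.pinchedBelow_ruinProb hv hR hrate hF₀
  have htheta : (fun x => ruinProb μ (R x)) =Θ[atTop] fun x => x ^ 2 * μ.real {ω | x < ξ 0 ω} :=
    isTheta_of_exists_mul_le (.of_forall fun x => mul_nonneg (sq_nonneg x) (hnonneg x))
      (h.exists_le_ruinProb hv hR hrate hgt) (h.exists_ruinProb_le hv hR hrate hb₀ hb hF₀ hlt hgt)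
  refine ⟨hint, ?_, fun x₀ hx₀ => ?_⟩
  · exact hruin.exists_mul_le_and_le_mul (pinchedBelow_setIntegral_id_mul hF₀ hint)
      (htheta.trans (isTheta_setIntegral_id_mul hanti hnonneg hlt hgt).symm)
  · exact (hruin.mono (Set.Ici_subset_Ioi.2 hx₀)).exists_mul_le_and_le_mul
      (pinchedBelow_sq_mul hanti hF₀ hx₀) htheta

end RuinProbability

theorem mainTheorem5 {Ω : Type*} [MeasurableSpace Ω] (μ : Measure Ω) [IsProbabilityMeasure μ]
    (τ ξ : ℕ → Ω → ℝ)
    -- the inter-claim times and the claim sizes: two independent i.i.d. sequences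
    (hτ_meas : ∀ n, Measurable (τ n)) (hξ_meas : ∀ n, Measurable (ξ n))
    (hτ_nonneg : ∀ n, ∀ᵐ ω ∂μ, 0 ≤ τ n ω) (hξ_nonneg : ∀ n, ∀ᵐ ω ∂μ, 0 ≤ ξ n ω)
    (hindep : iIndepFun (Sum.elim τ ξ) μ)
    (hτ_ident : ∀ n, IdentDistrib (τ n) (τ 0) μ μ)
    (hξ_ident : ∀ n, IdentDistrib (ξ n) (ξ 0) μ μ)
    (hτ_mean : 0 < ∫ ω, τ 0 ω ∂μ)
    -- the premium rate
    (v : ℝ → ℝ) (hv_meas : Measurable v) (hv_nonneg : ∀ y, 0 ≤ v y)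
    (hv_bdd : ∃ M : ℝ, ∀ y, v y ≤ M)
    -- the risk reserve process started from `x`, for every `x > 0`
    (R : ℝ → ℝ → Ω → ℝ) (hR : ∀ x : ℝ, 0 < x → IsRiskReserve μ v τ ξ x (R x))
    -- the rate of convergence to the critical rate
    (θ : ℝ) (hv_rate : ApproachesAtRate v (criticalRate μ (τ 0) (ξ 0)) θ)
    (hθ : limitVariance μ (τ 0) (ξ 0) / (2 * ∫ ω, τ 0 ω ∂μ) < θ)
    (hτ_log : Integrable (fun ω => τ 0 ω ^ 2 * Real.log (1 + τ 0 ω)) μ)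
    -- the regularly varying tail of the claim size
    (β : ℝ) (hβ : 0 < β) (hβρ : β < ruinExponent μ (τ 0) (ξ 0) θ)
    (L : ℝ → ℝ) (hL : SlowlyVarying L)
    (htail : ∀ x : ℝ, 0 < x → μ.real {ω | x < ξ 0 ω} = x ^ (-2 - β) * L x) :
    IntegrableOn (fun y : ℝ => y * μ.real {ω | y < ξ 0 ω}) (Set.Ioi 0) ∧
    (∃ C₁ C₂ : ℝ, 0 < C₁ ∧ 0 < C₂ ∧ ∀ x : ℝ, 0 < x →
      C₁ * (∫ y in Set.Ioi x, y * μ.real {ω | y < ξ 0 ω}) ≤ ruinProb μ (R x) ∧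
      ruinProb μ (R x) ≤ C₂ * ∫ y in Set.Ioi x, y * μ.real {ω | y < ξ 0 ω}) ∧
    (∀ x₀ : ℝ, 0 < x₀ → ∃ C₁ C₂ : ℝ, 0 < C₁ ∧ 0 < C₂ ∧ ∀ x : ℝ, x₀ ≤ x →
      C₁ * (x ^ 2 * μ.real {ω | x < ξ 0 ω}) ≤ ruinProb μ (R x) ∧
      ruinProb μ (R x) ≤ C₂ * (x ^ 2 * μ.real {ω | x < ξ 0 ω})) := by
  have hanti := antitone_measureReal_lt (μ := μ) (ξ 0)
  have hF₀ := hL.pos_of_antitone htail hanti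
  have hlt := hL.doublingLT htail hF₀ (show -2 - β < -2 by linarith)
  have hτ_memLp : MemLp (τ 0) 2 μ := memLp_two_of_integrable_sq_mul_log
    (hτ_meas 0).aestronglyMeasurable (hτ_nonneg 0) hτ_log
  have hξ_memLp : MemLp (ξ 0) 2 μ := by
    simpa using hlt.memLp (hξ_meas 0).aemeasurable (hξ_nonneg 0) two_pos
  obtain ⟨b, hβb, hbρ⟩ := exists_between hβρ
  exact mainTheorem5_general ⟨hτ_meas, hξ_meas, hτ_nonneg, hξ_nonneg, hindep, hτ_ident, hξ_ident,
    hτ_mean, hτ_memLp, hξ_memLp⟩ hv_nonneg hR hv_rate.tendsto_mul_sub hbρ hF₀ hlt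
    (hL.doublingGT htail hF₀ (by linarith))
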